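/- **Conventions.** A metric graph $\Gamma$ is obtained from a finite graph (loops, multiple edges allowed) by assigning to each edge a segment of finite positive length. For $v\in\Gamma$ let $T_v(\Gamma)$ be the finite set of outgoing tangent vectors at $v$ and $\mathrm{val}(v)=|T_v(\Gamma)|$. $\mathrm{PL}(\Gamma)$ is the set of continuous piecewise linear functions $f:\Gamma\to\mathbb R$ with integer slopes, $\mathrm{sl}_\eta(f)$ is the outgoing slope of $f$ along $\eta\in T_v(\Gamma)$, and $\mathrm{div}(f)=\sum_v \mathrm{ord}_v(f)\,v$ with $\mathrm{ord}_v(f)=-\sum_{\eta\in T_v(\Gamma)}\mathrm{sl}_\eta(f)$. A divisor is a finitely supported function $D:\Gamma\to\mathbb Z$; it is effective if $D\ge 0$; and $R(D)=\{f\in\mathrm{PL}(\Gamma): D+\mathrm{div}(f)\ge 0\}$. A set of functions is a tropical submodule if it is closed under tropical linear combinations $\min\{f_1+a_1,\dots,f_n+a_n\}$, $a_i\in\mathbb R$, $n\ge1$; it is finitely generated if it consists of all tropical linear combinations of elements of some finite set. Functions $f_1,\dots,f_n$ are tropically dependent if there are $a_i\in\mathbb R$ such that at every point of $\Gamma$ the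 minimum of the $f_i+a_i$ is attained for at least two indices. **Tropical linear series.** $(D,\Sigma)$ is a tropical linear series of rank $r$ if $\Sigma\subseteq R(D)$ is a finitely generated tropical submodule such that (1) for every effective divisor $E$ of degree $r$ there is $f\in\Sigma$ with $\mathrm{div}(f)+D\ge E$, and (2) every set of $r+2$ functions in $\Sigma$ is tropically dependent. **Permutation arrays.** Let $[r]=\{0,\dots,r\}$, and give $[r]^d$ the coordinatewise order. For $P\subseteq[r]^d$ and $x\in[r]^d$ let $P[x]=\{y\in P: y\ge x\}$. $P$ is rankable of rank $s$ if for every $i$ the $i$-th coordinates of the elements of $P$ take exactly $s+1$ values; it is totally rankable if all $P[x]$ are rankable, and then $\rho_P(x)$ is the rank of $P[x]$ (for $d=0$ one puts $\rho_P=r$). A point $x\in[r]^d$ is redundant if it is the coordinatewise minimum of a set of at least two elements of $P$, each of which has a coordinate in common with $x$. A permutation array of rank $r$ and dimension $d$ is a totally rankable $P\subseteq[r]^d$ of rank $r$ that contains no redundant point; $\overline P$ is the union of $P$ and the set of its redundant points. The standard one is $\{x\in[r]^d:\sum_i x_i=r\}$. **Slope structures.** Let $V\subset\Gamma$ be a finite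 set containing all points of valence different from $2$. An $r$-slope structure $\mathfrak S$ on $(\Gamma,V)$ assigns to every tangent vector $\eta$ integers $s^\eta_0<\dots<s^\eta_r$, and to every $v\in\Gamma$ a permutation array $P_v$ of rank $r$ and dimension $\mathrm{val}(v)$ with coordinates indexed by $T_v(\Gamma)$, such that: on each connected component of $\Gamma\setminus V$ the $s^\eta_i$ are the same for all $\eta$ with the same orientation, and $s^\eta_i+s^\xi_{r-i}=0$ if $\eta,\xi$ have opposite orientations; and $P_v$ is the standard permutation array of rank $r$ and dimension $2$ for every $v\notin V$. A function $f\in\mathrm{PL}(\Gamma)$ is compatible with $\mathfrak S$ if for all $v$ and all $\eta\in T_v(\Gamma)$ there is an index $j_\eta$ with $\mathrm{sl}_\eta(f)=s^\eta_{j_\eta}$, and $\partial_v(f)=(j_\eta)_{\eta\in T_v(\Gamma)}\in\overline{P_v}$ for all $v$; then put $\rho_v(f)=\rho_{P_v}(\partial_v(f))$. Let $R(D,\mathfrak S)$ be the set of all $f\in R(D)$ compatible with $\mathfrak S$. **Combinatorial limit linear series.** $(D,\Sigma)$ is a combinatorial limit linear series of rank $r$ if $\Sigma\subseteq R(D)$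 is a finitely generated tropical submodule, closed in $\mathrm{PL}(\Gamma)$ for the supremum norm, such that every set of $r+2$ functions in $\Sigma$ is tropically dependent, and there is an $r$-slope structure $\mathfrak S$ (for some $V$) such that $\Sigma\subseteq R(D,\mathfrak S)$ and for every effective divisor $E$ of degree $r$ there is $f\in\Sigma$ with both $\mathrm{div}(f)+D\ge E$ and $\rho_v(f)\ge E(v)$ for all $v\in\Gamma$. **Corollary.** Let $\Gamma$ be a metric graph, $D$ a divisor on $\Gamma$, $\Sigma$ a set of real-valued functions on $\Gamma$, and $r\in\{0,1,2\}$. Then $(D,\Sigma)$ is a tropical linear series of rank $r$ if and only if it is a combinatorial limit linear series of rank $r$. -/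

import Mathlib

/-- A metric graph: a multigraph (loops and multiple edges allowed) with vertex type `V` and edge
type `E`, both taken finite below, in which every edge `e` is a segment of length `len e`, running
from `src e` to `tgt e`. The choice of direction of an edge is auxiliary. -/
structure MetricGraph (V E : Type*) where
  src : E → V
  tgt : E → V
  len : E → ℝ
  len_pos : ∀ e, 0 < len e

namespace MetricGraph

/-- The points of the metric graph: vertices and interior points of edges. -/
inductive Point {V E : Type*} (Γ : MetricGraph V E)
  | vertex (v : V) : Point Γ
  | interior (e : E) (t : ℝ) (pos : 0 < t) (lt : t < Γ.len e) : Point Γ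

open Classical in
/-- The point at distance `t` from the start of the edge `e`, for `0 ≤ t ≤ len e`. -/
noncomputable def pt {V E : Type*} (Γ : MetricGraph V E) (e : E) (t : ℝ) : Γ.Point :=
  if h₀ : 0 < t then
    if h₁ : t < Γ.len e then Point.interior e t h₀ h₁ else Point.vertex (Γ.tgt e)
  else Point.vertex (Γ.src e)

/-- The tangent vectors of the metric graph: at each position on an edge, the direction of
increasing parameter (unless we are at the end) and that of decreasing parameter (unless we are
at the start). -/
inductive Tangent {V E : Type*} (Γ : MetricGraph V E)
  | fwd (e : E) (s : ℝ) (nonneg : 0 ≤ s) (lt : s < Γ.len e) : Tangent Γ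
  | bwd (e : E) (s : ℝ) (pos : 0 < s) (le : s ≤ Γ.len e) : Tangent Γ

variable {V E : Type*} {Γ : MetricGraph V E}

/-- The point reached from the base point of `η` by moving a (small) distance `t` along `η`. -/
noncomputable def Tangent.ray : Γ.Tangent → ℝ → Γ.Point
  | .fwd e s _ _, t => Γ.pt e (s + t)
  | .bwd e s _ _, t => Γ.pt e (s - t)

/-- The point at which a tangent vector is based. -/
noncomputable def Tangent.base (η : Γ.Tangent) : Γ.Point := η.ray 0

/-- The set `T_v(Γ)` of outgoing tangent vectors at a point. -/
abbrev TangentAt (v : Γ.Point) : Type _ := {η : Γ.Tangent // η.base = v}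

theorem pt_injective {e : E} {s t : ℝ} (hs : 0 ≤ s) (ht : 0 ≤ t) (hs' : s ≤ Γ.len e)
    (ht' : t ≤ Γ.len e) (h : s < Γ.len e ∧ t < Γ.len e ∨ 0 < s ∧ 0 < t)
    (heq : Γ.pt e s = Γ.pt e t) : s = t := by
  unfold pt at heq
  split_ifs at heq <;> simp_all <;> grind

instance finite_tangentAt [Finite E] (v : Γ.Point) : Finite (TangentAt v) := by
  let key : TangentAt v → E × Bool := fun η =>
    match η.1 with
    | .fwd e _ _ _ => (e, true)
    | .bwd e _ _ _ => (e, false)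
  refine Finite.of_injective key ?_
  rintro ⟨η, hη⟩ ⟨ξ, hξ⟩ h
  apply Subtype.ext
  have hb : η.base = ξ.base := hη.trans hξ.symm
  rcases η with ⟨e, s, h₀, h₁⟩ | ⟨e, s, h₀, h₁⟩ <;>
  rcases ξ with ⟨e', s', h₀', h₁'⟩ | ⟨e', s', h₀', h₁'⟩ <;>
  simp [key, Tangent.base, Tangent.ray] at h hb ⊢
  · subst h
    exact ⟨rfl, pt_injective h₀ h₀' h₁.le h₁'.le (Or.inl ⟨h₁, h₁'⟩) hb⟩
  · subst h
    exact ⟨rfl, pt_injective h₀.le h₀'.le h₁ h₁' (Or.inr ⟨h₀, h₀'⟩) hb⟩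

noncomputable instance fintypeTangentAt [Finite E] (v : Γ.Point) : Fintype (TangentAt v) :=
  Fintype.ofFinite _

/-- The valence of a point. -/
noncomputable def valence (v : Γ.Point) : ℕ := Nat.card (TangentAt v)

/-! ### Piecewise linear functions and divisors -/

/-- `f ∈ PL(Γ)`: on every (closed) edge there are finitely many break points, and `f` is affine
with integer slope on every closed subsegment without a break point in its interior. Continuity on
`Γ` is part of this, because the segments are closed and `f` is a function on the points of `Γ`. -/
def IsPL (f : Γ.Point → ℝ) : Prop :=
  ∀ e : E, ∃ B : Finset ℝ, ∀ s t : ℝ, 0 ≤ s → s ≤ t → t ≤ Γ.len e →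
    (∀ b ∈ B, b ∉ Set.Ioo s t) →
    ∃ k : ℤ, ∀ u ∈ Set.Icc s t, f (Γ.pt e u) = f (Γ.pt e s) + k * (u - s)

/-- `f` is affine of slope `k` along an initial piece of the tangent vector `η`. -/
def HasSlope (f : Γ.Point → ℝ) (η : Γ.Tangent) (k : ℤ) : Prop :=
  ∃ ε : ℝ, 0 < ε ∧ ∀ t ∈ Set.Icc 0 ε, f (η.ray t) = f η.base + k * t

open Classical in
/-- The outgoing slope `sl_η(f)`. It exists for piecewise linear `f` (the value `0` otherwise
is irrelevant). -/
noncomputable def outSlope (f : Γ.Point → ℝ) (η : Γ.Tangent) : ℤ :=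
  if h : ∃ k, HasSlope f η k then h.choose else 0

/-- The order of vanishing of `f` at `v`, that is, the coefficient of `v` in `div(f)`. -/
noncomputable def ord [Finite E] (f : Γ.Point → ℝ) (v : Γ.Point) : ℤ :=
  -∑ η : TangentAt v, outSlope f η.1

/-- Divisors are finitely supported integer valued functions on the points. -/
abbrev Divisor (Γ : MetricGraph V E) : Type _ := Γ.Point →₀ ℤ

/-- The degree of a divisor. -/
def Divisor.deg (D : Γ.Divisor) : ℤ := D.sum fun _ n => n

/-- The complete linear series `R(D)`. -/
def completeLinearSeries [Finite E] (D : Γ.Divisor) : Set (Γ.Point → ℝ) :=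
  {f | IsPL f ∧ ∀ v, 0 ≤ D v + ord f v}

/-! ### Tropical linear algebra -/

/-- The tropical linear combination `min {f₀ + a₀, …, fₙ + aₙ}`. -/
noncomputable def tropicalCombination {n : ℕ} (f : Fin (n + 1) → Γ.Point → ℝ)
    (a : Fin (n + 1) → ℝ) : Γ.Point → ℝ :=
  fun x => Finset.univ.inf' Finset.univ_nonempty fun i => f i x + a i

/-- A set of functions closed under tropical linear combinations. -/
def IsTropicalSubmodule (L : Set (Γ.Point → ℝ)) : Prop :=
  ∀ (n : ℕ) (f : Fin (n + 1) → Γ.Point → ℝ) (a : Fin (n + 1) → ℝ),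
    (∀ i, f i ∈ L) → tropicalCombination f a ∈ L

/-- The set of all tropical linear combinations of functions in `G`. -/
def tropicalSpan (G : Set (Γ.Point → ℝ)) : Set (Γ.Point → ℝ) :=
  {g | ∃ (n : ℕ) (f : Fin (n + 1) → Γ.Point → ℝ) (a : Fin (n + 1) → ℝ),
    (∀ i, f i ∈ G) ∧ g = tropicalCombination f a}

/-- Finitely generated sets of functions. -/
def IsFinitelyGenerated (L : Set (Γ.Point → ℝ)) : Prop :=
  ∃ G : Set (Γ.Point → ℝ), G.Finite ∧ L = tropicalSpan G

/-- Tropical dependence: for suitable real `aᵢ`, the minimum of the functions `fᵢ + aᵢ` is attained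
at least twice at every point. -/
def TropicallyDependent {n : ℕ} (f : Fin n → Γ.Point → ℝ) : Prop :=
  ∃ a : Fin n → ℝ, ∀ x, ∃ i j, i ≠ j ∧ f i x + a i = f j x + a j ∧
    ∀ k, f i x + a i ≤ f k x + a k

/-- Every set of `n` functions in `L` is tropically dependent. -/
def AllTropicallyDependent (n : ℕ) (L : Set (Γ.Point → ℝ)) : Prop :=
  ∀ f : Fin n → Γ.Point → ℝ, Function.Injective f → (∀ i, f i ∈ L) → TropicallyDependent f

/-- The Baker-Norine rank property of `f` for `E'`: `div(f) + D ≥ E'`. -/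
def BakerNorineRankProperty [Finite E] (D E' : Γ.Divisor) (f : Γ.Point → ℝ) : Prop :=
  ∀ v, E' v ≤ ord f v + D v

/-- Tropical linear series of rank `r`. -/
structure IsTropicalLinearSeries [Finite E] (r : ℕ) (D : Γ.Divisor) (L : Set (Γ.Point → ℝ)) :
    Prop where
  subset : L ⊆ completeLinearSeries D
  submodule : IsTropicalSubmodule L
  finitelyGenerated : IsFinitelyGenerated L
  bakerNorine : ∀ E' : Γ.Divisor, 0 ≤ E' → E'.deg = r → ∃ f ∈ L, BakerNorineRankProperty D E' f
  dependent : AllTropicallyDependent (r + 2) L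

end MetricGraph

/-! ### Permutation arrays -/

/-- A dot array in `[r]^ι`, where `[r] = {0, …, r}`. The coordinates are indexed by an arbitrary
finite type, since none of the notions below depends on an ordering of the coordinates. -/
abbrev DotArray (ι : Type*) (r : ℕ) : Type _ := Set (ι → Fin (r + 1))

namespace DotArray

variable {ι : Type*} {r : ℕ}

/-- The principal subarray `P[x]`. -/
def principal (P : DotArray ι r) (x : ι → Fin (r + 1)) : DotArray ι r := {y | y ∈ P ∧ x ≤ y}

/-- The rank of `P` along the `i`-axis. -/
noncomputable def rankAlong (P : DotArray ι r) (i : ι) : ℤ :=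
  (((fun x : ι → Fin (r + 1) => x i) '' P).ncard : ℤ) - 1

/-- `P` is rankable of rank `s`. -/
def IsRankable (P : DotArray ι r) (s : ℤ) : Prop := ∀ i, rankAlong P i = s

/-- `P` is totally rankable. -/
def IsTotallyRankable (P : DotArray ι r) : Prop := ∀ x, ∃ s, IsRankable (principal P x) s

/-- The rank array of a totally rankable `P`: the `s` for which `P[x]` is rankable of rank `s`.
In positive dimension there is exactly one such `s`, and it is at most `r`; taking the largest
`s ≤ r` only matters in dimension `0`, where it fixes the rank of the single position to be `r`. -/
noncomputable def rankArray (P : DotArray ι r) (x : ι → Fin (r + 1)) : ℤ :=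
  sSup {s : ℤ | s ≤ r ∧ IsRankable (principal P x) s}

/-- `x` is redundant: it is the meet of a set `H` of at least two elements of `P`, each of which
has a coordinate in common with `x`. -/
def IsRedundant (P : DotArray ι r) (x : ι → Fin (r + 1)) : Prop :=
  ∃ H : Set (ι → Fin (r + 1)), H ⊆ P ∧ H.Nontrivial ∧ (∀ y ∈ H, ∃ i, y i = x i) ∧ IsGLB H x

/-- Permutation arrays of rank `r`: totally rankable of rank `r`, with no redundant dots. -/
structure IsPermutationArray (P : DotArray ι r) : Prop where
  totallyRankable : IsTotallyRankable P
  rank_eq : IsRankable P r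
  not_redundant : ∀ x ∈ P, ¬ IsRedundant P x

/-- The redundant closure `P ∪ R(P)`. -/
def redundantClosure (P : DotArray ι r) : DotArray ι r := P ∪ {x | IsRedundant P x}

/-- The standard permutation array. -/
def standard (ι : Type*) [Fintype ι] (r : ℕ) : DotArray ι r := {x | ∑ i, (x i : ℕ) = r}

end DotArray

/-! ### Slope structures and combinatorial limit linear series -/

namespace MetricGraph

variable {V E : Type*} {Γ : MetricGraph V E}

/-- An `r`-slope structure on `(Γ, W)`, where `W` is a finite set of points that contains all points
of valence different from `2`. The array at `v` has its coordinates indexed by `T_v(Γ)`.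

Every component of `Γ ∖ W` is an open segment or a circle, and it is made of subsegments of edges
that are glued at points of valence two. Two tangent vectors at the ends of a subsegment of an edge
that lies in `Γ ∖ W`, both pointing into the subsegment, have opposite directions in the component
(`S_segment`), as have the two tangent vectors at a point outside `W` (`S_point`). Any two tangent
vectors in a component, in equal or opposite direction, are linked by such pairs, so that the two
fields say that `S` is constant on each direction of a component and is turned into `-S`,
in reversed order, in the opposite direction. -/
structure SlopeStructure [Finite E] (Γ : MetricGraph V E) (W : Set Γ.Point) (r : ℕ) where
  finite : W.Finite
  mem_of_valence : ∀ v : Γ.Point, valence v ≠ 2 → v ∈ W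
  S : Γ.Tangent → Fin (r + 1) → ℤ
  S_strictMono : ∀ η, StrictMono (S η)
  P : ∀ v : Γ.Point, DotArray (TangentAt v) r
  P_permutation : ∀ v, (P v).IsPermutationArray
  S_segment : ∀ (e : E) (s t : ℝ) (h₀ : 0 ≤ s) (h : s < t) (h₁ : t ≤ Γ.len e),
    (∀ u ∈ Set.Icc s t, Γ.pt e u ∉ W) →
    ∀ i, S (.fwd e s h₀ (h.trans_le h₁)) i + S (.bwd e t (h₀.trans_lt h) h₁) i.rev = 0
  S_point : ∀ v ∉ W, ∀ η ξ : TangentAt v, η ≠ ξ → ∀ i, S η.1 i + S ξ.1 i.rev = 0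
  P_standard : ∀ v ∉ W, P v = DotArray.standard (TangentAt v) r

namespace SlopeStructure

variable [Finite E] {W : Set Γ.Point} {r : ℕ}

/-- The vector `∂_v(f)` of the indices `j` with `sl_η(f) = S^η_j`, for `η ∈ T_v(Γ)`; meaningful if
all these slopes occur in `S`. -/
noncomputable def jump (𝔖 : SlopeStructure Γ W r) (f : Γ.Point → ℝ) (v : Γ.Point) :
    TangentAt v → Fin (r + 1) :=
  fun η => Classical.epsilon fun j => 𝔖.S η.1 j = outSlope f η.1

/-- `f` is compatible with `𝔖`. -/
def Compatible (𝔖 : SlopeStructure Γ W r) (f : Γ.Point → ℝ) : Prop :=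
  (∀ η : Γ.Tangent, outSlope f η ∈ Set.range (𝔖.S η)) ∧
    ∀ v : Γ.Point, 𝔖.jump f v ∈ (𝔖.P v).redundantClosure

/-- The rank `ρ_v(f)` of a compatible function at `v`. -/
noncomputable def rankAt (𝔖 : SlopeStructure Γ W r) (f : Γ.Point → ℝ) (v : Γ.Point) : ℤ :=
  (𝔖.P v).rankArray (𝔖.jump f v)

/-- The set `R(D, 𝔖)`. -/
def linearSeries (𝔖 : SlopeStructure Γ W r) (D : Γ.Divisor) : Set (Γ.Point → ℝ) :=
  {f | f ∈ completeLinearSeries D ∧ 𝔖.Compatible f}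

/-- The local rank property of `f` for `E'`. -/
def LocalRankProperty (𝔖 : SlopeStructure Γ W r) (E' : Γ.Divisor) (f : Γ.Point → ℝ) : Prop :=
  ∀ v, E' v ≤ 𝔖.rankAt f v

end SlopeStructure

/-- `L` is closed in `PL(Γ)` for the topology induced by the supremum norm. -/
def IsClosedInPL (L : Set (Γ.Point → ℝ)) : Prop :=
  ∀ f : Γ.Point → ℝ, IsPL f → (∀ ε : ℝ, 0 < ε → ∃ g ∈ L, ∀ x, |f x - g x| < ε) → f ∈ L

/-- Admissible submodules of `R(D)` of rank `r`. -/
structure IsAdmissible [Finite E] (r : ℕ) (D : Γ.Divisor) (L : Set (Γ.Point → ℝ)) : Prop where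
  subset : L ⊆ completeLinearSeries D
  submodule : IsTropicalSubmodule L
  closed : IsClosedInPL L
  slopeStructure : ∃ (W : Set Γ.Point) (𝔖 : SlopeStructure Γ W r),
    L ⊆ 𝔖.linearSeries D ∧
    ∀ E' : Γ.Divisor, 0 ≤ E' → E'.deg = r →
      ∃ f ∈ L, BakerNorineRankProperty D E' f ∧ 𝔖.LocalRankProperty E' f

/-- Combinatorial limit linear series of rank `r`. -/
structure IsCombinatorialLimitLinearSeries [Finite E] (r : ℕ) (D : Γ.Divisor)
    (L : Set (Γ.Point → ℝ)) : Prop where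
  admissible : IsAdmissible r D L
  finitelyGenerated : IsFinitelyGenerated L
  dependent : AllTropicallyDependent (r + 2) L

end MetricGraph

/-! A combinatorial limit linear series becomes a tropical linear series by forgetting the slope
structure. The content is the converse: a tropical linear series `L` of rank `r ≤ 2` is closed and
carries a suitable slope structure, which can be read off from `L`.

Along each tangent vector the functions of `L` have exactly `r + 1` slopes. There are at least that
many because `r` chips on a short initial segment force `r` slope drops (`lt_ncard_slopeSet`), and
no more because `r + 2` functions with distinct slopes would be tropically independent
(`ncard_slopeSet_le`). With slopes replaced by their indices, `L` gives a set of dots at each point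
(`jumpArray`). This set is closed under meets (take minima of functions normalized at the point),
has no chain of `r + 2` dots (dependence), and realizes every index on every axis. Moreover, for any
`r` tangent vectors some dot is nonzero along all of them. This last property is a compactness
argument (`exists_outSlope_lt`): let `r` chips run into the base points and pass to a limit `f` of
the normalized coefficients. A late member `h` of the sequence then has slopes at least those of
`f`, strictly larger along the chosen vectors.

For `r ≤ 2` these properties already imply total rankability (`isTotallyRankable_of_rank_le_two`).
Pruning a totally rankable array of rank `r` gives a permutation array with the same ranks, whose
redundant closure contains the original array. Away from the vertices, the break points of
generators and the support of `D`, all dots lie on or below the antidiagonal, and pruning gives the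
standard array (`prune_eq_standard`).

An effective divisor of degree `r ≤ 2` is zero, supported at one point, or a sum of two distinct
points. A function with minimal slopes at the point serves in the second case. The limit `f`, for
one tangent vector at each point, serves in the third unless a point is isolated. Comparing slopes
yields both rank properties. Closedness follows by taking the largest admissible coefficients
(`isTropComb_iSup`). -/

namespace DotArray

/-! ### Pruning totally rankable arrays -/

variable {ι : Type*} {r : ℕ}

/-- The dots of `X` that have no coordinate in common with a larger dot of `X`. -/
def prune (X : DotArray ι r) : DotArray ι r := {x | x ∈ X ∧ ∀ y ∈ X, x < y → ∀ i, y i ≠ x i}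

theorem not_isRedundant_prune {X : DotArray ι r} {x : ι → Fin (r + 1)} (hx : x ∈ X.prune) :
    ¬ IsRedundant X.prune x := by
  rintro ⟨H, hH, hnt, hi, hglb⟩
  obtain ⟨h, hh, hne⟩ := hnt.exists_ne x
  obtain ⟨i, hi⟩ := hi h hh
  exact hx.2 h (hH hh).1 (lt_of_le_of_ne (hglb.1 hh) hne.symm) i hi

theorem finite_image_coord (X : DotArray ι r) (i : ι) :
    ((fun x : ι → Fin (r + 1) => x i) '' X).Finite := Set.toFinite _

/-- In a totally rankable array, a dot that has one coordinate in common with a larger dot has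
every coordinate in common with some larger dot. -/
theorem IsTotallyRankable.exists_gt_coord_eq {X : DotArray ι r} (hX : X.IsTotallyRankable)
    {x y : ι → Fin (r + 1)} (hx : x ∈ X) (hy : y ∈ X) (hxy : x < y) {i : ι} (hi : y i = x i)
    (k : ι) : ∃ z ∈ X, x < z ∧ z k = x k := by
  by_contra! hcon
  obtain ⟨j, hj⟩ : ∃ j, x j < y j := by
    by_contra! h
    exact hxy.not_ge h
  have hk : x k < y k := lt_of_le_of_ne (hxy.le k) (hcon y hy hxy).symm
  classical
  -- Raising the `k`-th coordinate of `x` by one discards only `x` from `X[x]`. This loses the value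
  -- `x k` on the `k`-axis but nothing on the `i`-axis, where `y` replaces `x`. So the two principal
  -- subarrays cannot both be rankable.
  let s : Fin (r + 1) := ⟨x k + 1, by have := (y k).2; have : (x k : ℕ) < y k := hk; omega⟩
  obtain ⟨s₁, h₁⟩ := hX x
  obtain ⟨s₂, h₂⟩ := hX (Function.update x k s)
  have hprin : principal X (Function.update x k s) = principal X x \ {x} := by
    ext z
    constructor
    · rintro ⟨hz, hle⟩
      have hkz : (x k : ℕ) + 1 ≤ z k := by
        have := hle k
        rw [Function.update_self] at this
        exact this
      refine ⟨⟨hz, fun l => ?_⟩, fun h => ?_⟩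
      · by_cases hl : l = k
        · subst hl
          exact Fin.le_def.2 (by omega)
        · have := hle l
          rwa [Function.update_of_ne hl] at this
      · rw [Set.mem_singleton_iff] at h
        subst h
        omega
    · rintro ⟨⟨hz, hle⟩, hne⟩
      refine ⟨hz, fun l => ?_⟩
      by_cases hl : l = k
      · subst hl
        rw [Function.update_self]
        have h := hcon z hz (lt_of_le_of_ne hle fun h => hne h.symm)
        exact Nat.succ_le_of_lt (lt_of_le_of_ne (hle l) fun he => h (Fin.ext he.symm))
      · rw [Function.update_of_ne hl]
        exact hle l
  have hi' : (fun z : ι → Fin (r + 1) => z i) '' principal X (Function.update x k s) =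
      (fun z : ι → Fin (r + 1) => z i) '' principal X x := by
    rw [hprin]
    refine Set.Subset.antisymm (Set.image_mono Set.sdiff_subset) ?_
    rintro _ ⟨z, hz, rfl⟩
    by_cases hzx : z = x
    · exact ⟨y, ⟨⟨hy, hxy.le⟩, hxy.ne'⟩, by simp [hzx, hi]⟩
    · exact ⟨z, ⟨hz, hzx⟩, rfl⟩
  have hs : s₁ = s₂ := by
    rw [← h₁ i, ← h₂ i, rankAlong, rankAlong, hi']
  have hk' : (fun z : ι → Fin (r + 1) => z k) '' principal X (Function.update x k s) ⊂
      (fun z : ι → Fin (r + 1) => z k) '' principal X x := by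
    refine ⟨hprin ▸ Set.image_mono Set.sdiff_subset, fun h => ?_⟩
    obtain ⟨z, hz, hzk⟩ := h ⟨x, ⟨hx, le_rfl⟩, rfl⟩
    have := hz.2 k
    rw [Function.update_self] at this
    have h' : (x k : ℕ) + 1 ≤ z k := this
    have h'' : z k = x k := hzk
    omega
  have := Set.ncard_lt_ncard hk' (finite_image_coord _ _)
  have e₁ := h₁ k
  have e₂ := h₂ k
  simp only [rankAlong] at e₁ e₂
  omega

/-- A maximal dot among those above `x` with the same `k`-th coordinate survives: if it shared any
coordinate with a larger dot, it would share the `k`-th one with some larger dot. -/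
theorem IsTotallyRankable.exists_prune_coord_eq [Finite ι] {X : DotArray ι r}
    (hX : X.IsTotallyRankable) {x : ι → Fin (r + 1)} (hx : x ∈ X) (k : ι) :
    ∃ z ∈ X.prune, x ≤ z ∧ z k = x k := by
  obtain ⟨z, ⟨⟨hz, hxz, hk⟩, hmax⟩⟩ :=
    (Set.toFinite {z | z ∈ X ∧ x ≤ z ∧ z k = x k}).exists_maximal ⟨x, hx, le_rfl, rfl⟩
  refine ⟨z, ⟨hz, fun y hy hzy i hi => ?_⟩, hxz, hk⟩
  obtain ⟨w, hw, hzw, hwk⟩ := hX.exists_gt_coord_eq hz hy hzy hi k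
  exact hzw.not_ge (hmax ⟨hw, hxz.trans hzw.le, hwk.trans hk⟩ hzw.le)

/-- On each axis a discarded dot is replaced by a larger surviving dot with the same coordinate, so
ranks of principal subarrays do not change. -/
theorem IsTotallyRankable.rankAlong_prune [Finite ι] {X : DotArray ι r}
    (hX : X.IsTotallyRankable) (x : ι → Fin (r + 1)) (i : ι) :
    rankAlong (principal X.prune x) i = rankAlong (principal X x) i := by
  unfold rankAlong
  congr 3
  refine Set.Subset.antisymm (Set.image_mono fun y hy => ⟨hy.1.1, hy.2⟩) ?_
  rintro _ ⟨y, hy, rfl⟩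
  obtain ⟨z, hz, hyz, hzi⟩ := hX.exists_prune_coord_eq hy.1 i
  exact ⟨z, ⟨hz, hy.2.trans hyz⟩, hzi⟩

theorem principal_bot (X : DotArray ι r) : principal X ⊥ = X := by
  ext x
  simp [principal]

theorem IsTotallyRankable.isPermutationArray_prune [Finite ι] {X : DotArray ι r}
    (hX : X.IsTotallyRankable) (hr : X.IsRankable r) : X.prune.IsPermutationArray where
  totallyRankable x := by
    obtain ⟨s, hs⟩ := hX x
    exact ⟨s, fun i => (hX.rankAlong_prune x i).trans (hs i)⟩
  rank_eq i := by
    have := hX.rankAlong_prune ⊥ i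
    rw [principal_bot, principal_bot] at this
    exact this.trans (hr i)
  not_redundant _ hx := not_isRedundant_prune hx

/-- A discarded dot is the meet of surviving dots above it, one for each axis, agreeing with it on
that axis. They are not all equal, since otherwise they would equal the dot itself. -/
theorem IsTotallyRankable.subset_redundantClosure_prune [Finite ι] {X : DotArray ι r}
    (hX : X.IsTotallyRankable) : X ⊆ X.prune.redundantClosure := by
  intro x hx
  by_cases hP : x ∈ X.prune
  · exact Or.inl hP
  right
  choose z hz hxz hk using fun k => hX.exists_prune_coord_eq hx k
  have hne : ∀ k, z k ≠ x := fun k h => hP (h ▸ hz k)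
  have hglb : IsGLB (Set.range z) x := by
    refine ⟨by rintro _ ⟨k, rfl⟩; exact hxz k, fun y hy k => ?_⟩
    rw [← hk k]
    exact hy ⟨k, rfl⟩ k
  refine ⟨Set.range z, by rintro _ ⟨k, rfl⟩; exact hz k, ?_, ?_, hglb⟩
  · have : Nonempty ι := by
      by_contra h
      rw [not_nonempty_iff] at h
      exact hP ⟨hx, fun y _ hlt => (hlt.ne (Subsingleton.elim _ _)).elim⟩
    rw [← Set.not_subsingleton_iff]
    intro hs
    obtain ⟨k⟩ := this
    refine hne k (funext fun l => ?_)
    rw [← hk l, hs ⟨k, rfl⟩ ⟨l, rfl⟩]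
  · rintro _ ⟨k, rfl⟩
    exact ⟨k, hk k⟩

theorem rankAlong_le (X : DotArray ι r) (i : ι) : rankAlong X i ≤ r := by
  have := Set.ncard_le_card ((fun x : ι → Fin (r + 1) => x i) '' X)
  simp only [Nat.card_eq_fintype_card, Fintype.card_fin] at this
  simp only [rankAlong]
  omega

/-- Total rankability makes a bound on a single axis sufficient; in dimension zero the rank is `r`
by convention. -/
theorem IsTotallyRankable.le_rankArray_prune [Finite ι] {X : DotArray ι r}
    (hX : X.IsTotallyRankable) {x : ι → Fin (r + 1)} {k : ℤ} (hk : k ≤ r)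
    (h : IsEmpty ι ∨ ∃ i, k ≤ rankAlong (principal X x) i) : k ≤ X.prune.rankArray x := by
  have hb : BddAbove {s : ℤ | s ≤ r ∧ IsRankable (principal X.prune x) s} :=
    ⟨r, fun s hs => hs.1⟩
  rcases h with h | ⟨i, hi⟩
  · exact hk.trans (le_csSup hb ⟨le_rfl, fun i => h.elim i⟩)
  · obtain ⟨s, hs⟩ := hX x
    rw [hs i] at hi
    refine hi.trans (le_csSup hb ⟨?_, fun i => (hX.rankAlong_prune x i).trans (hs i)⟩)
    rw [← hs i]
    exact rankAlong_le _ _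

/-! ### Total rankability in rank at most two -/

theorem isRankable_of_coord_surjective {X : DotArray ι r} (h : ∀ i j, ∃ x ∈ X, x i = j) :
    X.IsRankable r := by
  intro i
  have : (fun x : ι → Fin (r + 1) => x i) '' X = Set.univ :=
    Set.eq_univ_of_forall fun j => h i j
  rw [rankAlong, this, Set.ncard_univ, Nat.card_eq_fintype_card, Fintype.card_fin]
  push_cast
  ring

/-- A minimal dot cannot be lowered by a meet with a dot whose `i`-th coordinate is zero, so its own
`i`-th coordinate is zero. -/
theorem bot_mem [Finite ι] {X : DotArray ι r} (hne : X.Nonempty)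
    (hinf : ∀ x ∈ X, ∀ y ∈ X, x ⊓ y ∈ X) (h : ∀ i j, ∃ x ∈ X, x i = j) : ⊥ ∈ X := by
  obtain ⟨z, hz, hmin⟩ := (Set.toFinite X).exists_minimal hne
  convert hz
  funext i
  obtain ⟨x, hx, hxi⟩ := h i ⊥
  have := hmin (hinf z hz x hx) inf_le_left i
  rw [Pi.inf_apply, hxi, inf_bot_eq, le_bot_iff] at this
  exact this.symm

/-- An array that is closed under meets, has no chains of `r + 2` dots, and has sufficiently many
dots is totally rankable if `r ≤ 2`. -/
theorem isTotallyRankable_of_rank_le_two [Finite ι] (hr : r = 0 ∨ r = 1 ∨ r = 2)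
    {X : DotArray ι r} (hinf : ∀ x ∈ X, ∀ y ∈ X, x ⊓ y ∈ X) (h : ∀ i j, ∃ x ∈ X, x i = j)
    (hchain : ∀ c : Fin (r + 2) → ι → Fin (r + 1), StrictMono c → ¬ ∀ m, c m ∈ X)
    (hmany : ∀ e : Fin r → ι, ∃ x ∈ X, ∀ m, x (e m) ≠ 0) : X.IsTotallyRankable := by
  intro x
  by_cases hne : (principal X x).Nonempty
  swap
  · rw [Set.not_nonempty_iff_eq_empty] at hne
    exact ⟨-1, fun i => by simp [hne, rankAlong]⟩
  -- By closure under meets `X[x]` has a least dot `z`, so it equals `X[z]`.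
  obtain ⟨z, ⟨hz, hxz⟩, hmin⟩ := (Set.toFinite (principal X x)).exists_minimal hne
  have hprin : principal X x = principal X z := by
    ext y
    refine ⟨fun hy => ⟨hy.1, ?_⟩, fun hy => ⟨hy.1, hxz.trans hy.2⟩⟩
    exact (hmin ⟨hinf z hz y hy.1, le_inf hxz hy.2⟩ inf_le_left).trans inf_le_right
  rw [hprin]
  by_cases hz0 : z = ⊥
  · rw [hz0, principal_bot]
    exact ⟨r, isRankable_of_coord_surjective h⟩
  have hz0' : ⊥ < z := bot_lt_iff_ne_bot.2 hz0
  have hbot : ⊥ ∈ X := bot_mem ⟨z, hz⟩ hinf h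
  by_cases hzm : ∃ w ∈ X, z < w
  swap
  · have : principal X z = {z} := by
      ext y
      refine ⟨fun hy => ?_, fun hy => ?_⟩
      · by_contra hne
        exact hzm ⟨y, hy.1, lt_of_le_of_ne hy.2 (Ne.symm hne)⟩
      · rw [Set.mem_singleton_iff] at hy
        rw [hy]
        exact ⟨hz, le_rfl⟩
    exact ⟨0, fun i => by simp [this, rankAlong]⟩
  obtain ⟨w, hw, hzw⟩ := hzm
  -- A dot strictly between `⊥` and another dot can exist only for `r = 2`.
  rcases hr with rfl | rfl | rfl
  · exact (hz0 (funext fun i => Subsingleton.elim (α := Fin 1) _ _)).elim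
  · refine (hchain ![⊥, z, w] ?_ ?_).elim
    · rw [Fin.strictMono_iff_lt_succ]
      intro i
      fin_cases i
      exacts [hz0', hzw]
    · intro m
      fin_cases m
      exacts [hbot, hz, hw]
  have hch : ∀ a ∈ X, ∀ b ∈ X, ∀ c ∈ X, ⊥ < a → a < b → b < c → False := by
    intro a ha b hb c hc h₁ h₂ h₃
    refine hchain ![⊥, a, b, c] ?_ ?_
    · rw [Fin.strictMono_iff_lt_succ]
      intro i
      fin_cases i
      exacts [h₁, h₂, h₃]
    · intro m
      fin_cases m
      exacts [hbot, ha, hb, hc]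
  -- Otherwise `⊥ < z ⊓ y < z < w` would be a chain of four dots.
  have hle : ∀ y ∈ X, ∀ i, z i ≠ 0 → y i ≠ 0 → z ≤ y := by
    intro y hy i hzi hyi
    by_contra hzy
    refine hch (z ⊓ y) (hinf z hz y hy) z hz w hw ?_ ?_ hzw
    · refine bot_lt_iff_ne_bot.2 fun h0 => ?_
      have := congrFun h0 i
      simp only [Pi.inf_apply, Pi.bot_apply] at this
      rcases min_choice (z i) (y i) with hc | hc <;> rw [hc] at this
      exacts [hzi this, hyi this]
    · exact inf_lt_left.2 hzy
  obtain ⟨k, hk⟩ : ∃ k, z k ≠ 0 := by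
    by_contra! hcon
    exact hz0 (funext hcon)
  refine ⟨1, fun i => ?_⟩
  suffices hS : ∃ a b : Fin 3, a ≠ b ∧
      (fun y : ι → Fin 3 => y i) '' principal X z = {a, b} by
    obtain ⟨a, b, hab, hS⟩ := hS
    rw [rankAlong]
    erw [hS]
    rw [Set.ncard_pair hab]
    norm_num
  -- If `z i = 0`, then `hmany` and `hle` give a dot `y` above `z` with `y i ≠ 0`. The chain bound
  -- makes it the only such dot, so the values on this axis are `0` and `y i`.
  by_cases hzi : z i = 0
  · obtain ⟨y, hy, hye⟩ := hmany ![i, k]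
    have hyi : y i ≠ 0 := hye 0
    have hyk : y k ≠ 0 := hye 1
    have hzy := hle y hy k hk hyk
    refine ⟨0, y i, hyi.symm, Set.Subset.antisymm ?_ ?_⟩
    · rintro _ ⟨y', hy', rfl⟩
      by_cases hyi' : y' i = 0
      · exact Or.inl hyi'
      right
      have hlt : z < y ⊓ y' := by
        refine lt_of_le_of_ne (le_inf hzy hy'.2) fun he => ?_
        have := congrFun he i
        simp only [Pi.inf_apply, hzi] at this
        rcases min_choice (y i) (y' i) with hc | hc <;> rw [hc] at this
        exacts [hyi this.symm, hyi' this.symm]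
      have h₁ : y ≤ y' := by
        by_contra hn
        exact hch z hz _ (hinf y hy y' hy'.1) y hy hz0' hlt (inf_lt_left.2 hn)
      have h₂ : y' ≤ y := by
        by_contra hn
        exact hch z hz _ (hinf y hy y' hy'.1) y' hy'.1 hz0' hlt (inf_lt_right.2 hn)
      exact congrFun (le_antisymm h₂ h₁) i
    · rintro j (rfl | rfl)
      · exact ⟨z, ⟨hz, le_rfl⟩, hzi⟩
      · exact ⟨y, ⟨hy, hzy⟩, rfl⟩
  -- The dots with `i`-th coordinate `1` and `2` both lie above `z` by `hle`; hence `z i = 1` and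
  -- the values are `1` and `2`.
  · obtain ⟨u, hu, hui⟩ := h i 1
    obtain ⟨p, hp, hpi⟩ := h i 2
    have hzu := hle u hu i hzi (by rw [hui]; decide) i
    have hzp := hle p hp i hzi (by rw [hpi]; decide)
    have hzi1 : z i = 1 := by
      rw [hui] at hzu
      rw [Fin.le_def] at hzu
      rw [Fin.ext_iff] at hzi
      rw [Fin.ext_iff]
      simp only [Fin.coe_ofNat_eq_mod] at hzu hzi ⊢
      omega
    refine ⟨1, 2, by decide, Set.Subset.antisymm ?_ ?_⟩
    · rintro _ ⟨y, hy, rfl⟩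
      have := hy.2 i
      rw [hzi1, Fin.le_def] at this
      have hlt := (y i).2
      simp only [Set.mem_insert_iff, Set.mem_singleton_iff, Fin.ext_iff]
      simp only [Fin.coe_ofNat_eq_mod] at this ⊢
      omega
    · rintro j (rfl | rfl)
      · exact ⟨z, ⟨hz, le_rfl⟩, hzi1⟩
      · exact ⟨p, ⟨hp, hzp⟩, hpi⟩

/-! ### Arrays in dimension two -/

/-- In dimension two, a totally rankable array of rank `r` below the antidiagonal prunes to the
standard array. -/
theorem prune_eq_standard [Fintype ι] {X : DotArray ι r} (hX : X.IsTotallyRankable)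
    (h : ∀ i j, ∃ x ∈ X, x i = j) {i k : ι} (hik : i ≠ k) (huniv : ∀ l, l = i ∨ l = k)
    (hsum : ∀ x ∈ X, (x i : ℕ) + x k ≤ r) : X.prune = standard ι r := by
  classical
  have hpair : (Finset.univ : Finset ι) = {i, k} := by
    ext l
    simpa using huniv l
  have hstd : ∀ x, x ∈ standard ι r ↔ (x i : ℕ) + x k = r := by
    intro x
    rw [standard, Set.mem_ofPred_eq, hpair, Finset.sum_pair hik]
  have hext : ∀ x y : ι → Fin (r + 1), x i = y i → x k = y k → x = y := by
    intro x y h₁ h₂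
    funext l
    rcases huniv l with rfl | rfl <;> assumption
  have hall : ∀ x, x ∈ standard ι r → x ∈ X := by
    intro x hx
    rw [hstd] at hx
    -- On the `i`-axis `X[b]` takes all `r + 1 - x i` values from `x i` on, while on the `k`-axis
    -- its values are at most `r - x i = x k`. Equal counts force the value `x k` to occur, and the
    -- only possible dot there is `x`.
    set b : ι → Fin (r + 1) := Function.update ⊥ i (x i) with hb
    have hbi : b i = x i := by simp [hb]
    have hprin : ∀ y, y ∈ principal X b ↔ y ∈ X ∧ x i ≤ y i := by
      intro y
      refine ⟨fun hy => ⟨hy.1, hbi ▸ hy.2 i⟩, fun hy => ⟨hy.1, fun l => ?_⟩⟩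
      by_cases hl : l = i
      · subst hl
        rw [hbi]
        exact hy.2
      · rw [hb, Function.update_of_ne hl]
        exact bot_le
    obtain ⟨s, hs⟩ := hX b
    have himi : (fun y : ι → Fin (r + 1) => y i) '' principal X b = Set.Ici (x i) := by
      ext j
      constructor
      · rintro ⟨y, hy, rfl⟩
        exact ((hprin y).1 hy).2
      · intro hj
        obtain ⟨y, hy, rfl⟩ := h i j
        exact ⟨y, (hprin y).2 ⟨hy, hj⟩, rfl⟩
    have himk : (fun y : ι → Fin (r + 1) => y k) '' principal X b ⊆ Set.Iic (x k) := by
      rintro _ ⟨y, hy, rfl⟩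
      have h₁ := hsum y hy.1
      have h₂ : (x i : ℕ) ≤ y i := ((hprin y).1 hy).2
      exact Fin.le_def.2 (by simp only; omega)
    have hIci : (Set.Ici (x i)).ncard = r + 1 - x i := by
      rw [Set.ncard_eq_toFinset_card', Set.toFinset_Ici, Fin.card_Ici]
    have hIic : (Set.Iic (x k)).ncard = x k + 1 := by
      rw [Set.ncard_eq_toFinset_card', Set.toFinset_Iic, Fin.card_Iic]
    have hsi := hs i
    have hsk := hs k
    simp only [rankAlong] at hsi hsk
    rw [himi, hIci] at hsi
    have heq := Set.eq_of_subset_of_ncard_le himk (by rw [hIic]; omega)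
    obtain ⟨y, hy, hyk⟩ : x k ∈ (fun y : ι → Fin (r + 1) => y k) '' principal X b := by
      rw [heq]
      exact Set.self_mem_Iic
    have h₁ := hsum y hy.1
    have h₂ : (x i : ℕ) ≤ y i := ((hprin y).1 hy).2
    have h₃ : y k = x k := hyk
    rw [h₃] at h₁
    rw [hext x y (Fin.ext (by omega)) h₃.symm]
    exact hy.1
  ext x
  constructor
  · intro hx
    by_contra hn
    have hlt : (x i : ℕ) + x k < r := lt_of_le_of_ne (hsum x hx.1) fun he => hn ((hstd x).2 he)
    -- A dot below the antidiagonal shares its `i`-th coordinate with the antidiagonal dot above it,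
    -- hence is pruned.
    set y : ι → Fin (r + 1) := Function.update x k ⟨r - x i, by omega⟩ with hy
    have hyi : y i = x i := by rw [hy, Function.update_of_ne hik]
    have hyk : (y k : ℕ) = r - x i := by rw [hy, Function.update_self]
    have hyX : y ∈ X := hall y ((hstd y).2 (by rw [hyi, hyk]; omega))
    refine hx.2 y hyX (lt_of_le_of_ne (fun l => ?_) fun he => ?_) i hyi
    · rcases huniv l with rfl | rfl
      · exact hyi.ge
      · exact Fin.le_def.2 (by omega)
    · rw [← he] at hyk
      omega
  · intro hx
    refine ⟨hall x hx, fun y hy hlt => ?_⟩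
    rw [hstd] at hx
    have := hsum y hy
    have h₁ : (x i : ℕ) ≤ y i := hlt.le i
    have h₂ : (x k : ℕ) ≤ y k := hlt.le k
    exact (hlt.ne (hext x y (Fin.ext (by omega)) (Fin.ext (by omega)))).elim

end DotArray

namespace MetricGraph

open Filter Topology

variable {V E : Type*} {Γ : MetricGraph V E}

/-! ### Slopes of piecewise linear functions -/

theorem HasSlope.eventually {f : Γ.Point → ℝ} {η : Γ.Tangent} {k : ℤ} (h : HasSlope f η k) :
    ∀ᶠ t in 𝓝[>] (0 : ℝ), f (η.ray t) = f η.base + k * t := by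
  obtain ⟨ε, hε, h⟩ := h
  filter_upwards [Ioo_mem_nhdsGT hε] with t ht
  exact h t ⟨ht.1.le, ht.2.le⟩

/-- Just beyond the base of `η`, functions compare lexicographically: first by value, then by slope.
-/
theorem HasSlope.eventually_lt {f g : Γ.Point → ℝ} {η : Γ.Tangent} {k l : ℤ}
    (hf : HasSlope f η k) (hg : HasSlope g η l) {a b : ℝ}
    (h : f η.base + a < g η.base + b ∨ f η.base + a = g η.base + b ∧ k < l) :
    ∀ᶠ t in 𝓝[>] (0 : ℝ), f (η.ray t) + a < g (η.ray t) + b := by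
  rcases h with h | ⟨h, hkl⟩
  · have hcf : Tendsto (fun t : ℝ => f η.base + k * t + a) (𝓝[>] 0) (𝓝 (f η.base + k * 0 + a)) :=
      (Continuous.tendsto (by fun_prop) 0).mono_left nhdsWithin_le_nhds
    have hcg : Tendsto (fun t : ℝ => g η.base + l * t + b) (𝓝[>] 0) (𝓝 (g η.base + l * 0 + b)) :=
      (Continuous.tendsto (by fun_prop) 0).mono_left nhdsWithin_le_nhds
    filter_upwards [hf.eventually, hg.eventually, hcf.eventually_lt hcg (by simpa using h)]
      with t h₁ h₂ h₃
    rwa [h₁, h₂]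
  · filter_upwards [hf.eventually, hg.eventually, self_mem_nhdsWithin] with t h₁ h₂ ht
    have : (k : ℝ) * t < l * t := mul_lt_mul_of_pos_right (by exact_mod_cast hkl) ht
    rw [h₁, h₂]
    linarith

theorem HasSlope.unique {f : Γ.Point → ℝ} {η : Γ.Tangent} {k l : ℤ} (hk : HasSlope f η k)
    (hl : HasSlope f η l) : k = l := by
  by_contra hne
  rcases lt_or_gt_of_ne hne with h | h
  · obtain ⟨t, ht⟩ := (hk.eventually_lt hl (a := 0) (b := 0) (Or.inr ⟨rfl, h⟩)).exists
    exact lt_irrefl _ ht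
  · obtain ⟨t, ht⟩ := (hl.eventually_lt hk (a := 0) (b := 0) (Or.inr ⟨rfl, h⟩)).exists
    exact lt_irrefl _ ht

theorem HasSlope.outSlope_eq {f : Γ.Point → ℝ} {η : Γ.Tangent} {k : ℤ} (h : HasSlope f η k) :
    outSlope f η = k := by
  have hex : ∃ k, HasSlope f η k := ⟨k, h⟩
  rw [outSlope, dif_pos hex]
  exact hex.choose_spec.unique h

/-- `f` is affine of slope `k` on the segment `[s, t]` of the edge `e`. -/
def IsAffineOn (f : Γ.Point → ℝ) (e : E) (s t : ℝ) (k : ℤ) : Prop :=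
  ∀ u ∈ Set.Icc s t, f (Γ.pt e u) = f (Γ.pt e s) + k * (u - s)

theorem IsAffineOn.apply_sub {f : Γ.Point → ℝ} {e : E} {s t : ℝ} {k : ℤ}
    (h : IsAffineOn f e s t k) {u v : ℝ} (hu : u ∈ Set.Icc s t) (hv : v ∈ Set.Icc s t) :
    f (Γ.pt e v) = f (Γ.pt e u) + k * (v - u) := by
  rw [h u hu, h v hv]
  ring

theorem IsAffineOn.hasSlope_fwd {f : Γ.Point → ℝ} {e : E} {s t : ℝ} {k : ℤ}
    (h : IsAffineOn f e s t k) {u : ℝ} (hu : u ∈ Set.Ico s t) (h₀ : 0 ≤ u) (h₁ : u < Γ.len e) :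
    HasSlope f (.fwd e u h₀ h₁) k := by
  refine ⟨t - u, sub_pos.2 hu.2, fun x hx => ?_⟩
  simp only [Tangent.base, Tangent.ray, add_zero]
  rw [h.apply_sub ⟨hu.1, hu.2.le⟩ ⟨by linarith [hu.1, hx.1], by linarith [hx.2]⟩]
  ring

theorem IsAffineOn.hasSlope_bwd {f : Γ.Point → ℝ} {e : E} {s t : ℝ} {k : ℤ}
    (h : IsAffineOn f e s t k) {u : ℝ} (hu : u ∈ Set.Ioc s t) (h₀ : 0 < u) (h₁ : u ≤ Γ.len e) :
    HasSlope f (.bwd e u h₀ h₁) (-k) := by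
  refine ⟨u - s, sub_pos.2 hu.1, fun x hx => ?_⟩
  simp only [Tangent.base, Tangent.ray, sub_zero]
  rw [h.apply_sub ⟨hu.1.le, hu.2⟩ ⟨by linarith [hx.2], by linarith [hu.2, hx.1]⟩]
  push_cast
  ring

/-- A right neighbourhood free of points of a finite set. -/
theorem exists_pos_forall_notMem (B : Finset ℝ) (s : ℝ) :
    ∃ ε : ℝ, 0 < ε ∧ ∀ b ∈ B, b ∉ Set.Ioo s (s + ε) ∧ b ∉ Set.Ioo (s - ε) s := by
  have h : ∀ᶠ ε in 𝓝[>] (0 : ℝ), ∀ b ∈ B, b ∉ Set.Ioo s (s + ε) ∧ b ∉ Set.Ioo (s - ε) s := by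
    rw [eventually_all_finset]
    intro b _
    by_cases hb : b = s
    · exact Eventually.of_forall fun ε => ⟨fun h => by simp [hb] at h, fun h => by simp [hb] at h⟩
    · filter_upwards [Ioo_mem_nhdsGT (abs_pos.2 (sub_ne_zero.2 hb))] with ε hε
      constructor
      · rintro ⟨h₁, h₂⟩
        have := hε.2
        rw [abs_of_pos (sub_pos.2 h₁)] at this
        linarith
      · rintro ⟨h₁, h₂⟩
        have := hε.2
        rw [abs_of_neg (sub_neg.2 h₂)] at this
        linarith
  obtain ⟨ε, h, hε⟩ := (h.and self_mem_nhdsWithin).exists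
  exact ⟨ε, hε, h⟩

theorem IsPL.exists_isAffineOn_right {f : Γ.Point → ℝ} (hf : IsPL f) (e : E) {s : ℝ}
    (h₀ : 0 ≤ s) (h₁ : s < Γ.len e) :
    ∃ ε : ℝ, 0 < ε ∧ s + ε ≤ Γ.len e ∧ ∃ k, IsAffineOn f e s (s + ε) k := by
  obtain ⟨B, hB⟩ := hf e
  obtain ⟨ε, hε, h⟩ := exists_pos_forall_notMem B s
  have hle : s + min ε (Γ.len e - s) ≤ Γ.len e := by linarith [min_le_right ε (Γ.len e - s)]
  have hpos : 0 < min ε (Γ.len e - s) := lt_min hε (sub_pos.2 h₁)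
  refine ⟨_, hpos, hle, hB _ _ h₀ (by linarith) hle fun b hb hmem => (h b hb).1 ⟨hmem.1, ?_⟩⟩
  exact hmem.2.trans_le (by gcongr; exact min_le_left _ _)

theorem IsPL.exists_isAffineOn_left {f : Γ.Point → ℝ} (hf : IsPL f) (e : E) {s : ℝ}
    (h₀ : 0 < s) (h₁ : s ≤ Γ.len e) :
    ∃ ε : ℝ, 0 < ε ∧ 0 ≤ s - ε ∧ ∃ k, IsAffineOn f e (s - ε) s k := by
  obtain ⟨B, hB⟩ := hf e
  obtain ⟨ε, hε, h⟩ := exists_pos_forall_notMem B s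
  have hle : 0 ≤ s - min ε s := by linarith [min_le_right ε s]
  have hpos : 0 < min ε s := lt_min hε h₀
  refine ⟨_, hpos, hle, hB _ _ hle (by linarith) h₁ fun b hb hmem => (h b hb).2 ⟨?_, hmem.2⟩⟩
  exact lt_of_le_of_lt (by gcongr; exact min_le_left _ _) hmem.1

theorem IsPL.exists_hasSlope {f : Γ.Point → ℝ} (hf : IsPL f) (η : Γ.Tangent) :
    ∃ k, HasSlope f η k := by
  rcases η with ⟨e, s, h₀, h₁⟩ | ⟨e, s, h₀, h₁⟩
  · obtain ⟨ε, hε, -, k, hk⟩ := hf.exists_isAffineOn_right e h₀ h₁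
    exact ⟨k, hk.hasSlope_fwd ⟨le_rfl, by linarith⟩ h₀ h₁⟩
  · obtain ⟨ε, hε, -, k, hk⟩ := hf.exists_isAffineOn_left e h₀ h₁
    exact ⟨-k, hk.hasSlope_bwd ⟨by linarith, le_rfl⟩ h₀ h₁⟩

theorem IsPL.hasSlope {f : Γ.Point → ℝ} (hf : IsPL f) (η : Γ.Tangent) :
    HasSlope f η (outSlope f η) := by
  obtain ⟨k, hk⟩ := hf.exists_hasSlope η
  rwa [hk.outSlope_eq]

theorem pt_of_mem_Ioo {e : E} {s : ℝ} (h₀ : 0 < s) (h₁ : s < Γ.len e) :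
    Γ.pt e s = .interior e s h₀ h₁ := by
  rw [pt, dif_pos h₀, dif_pos h₁]

theorem eq_of_pt_eq_interior {e e' : E} {s u : ℝ} {h₀ : 0 < s} {h₁ : s < Γ.len e}
    (h : Γ.pt e' u = .interior e s h₀ h₁) : e' = e ∧ u = s := by
  unfold pt at h
  split_ifs at h
  cases h
  exact ⟨rfl, rfl⟩

theorem IsPL.continuousOn {f : Γ.Point → ℝ} (hf : IsPL f) (e : E) :
    ContinuousOn (fun u => f (Γ.pt e u)) (Set.Icc 0 (Γ.len e)) := by
  intro s hs
  have hright : ContinuousWithinAt (fun u => f (Γ.pt e u)) (Set.Icc s (Γ.len e)) s := by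
    rcases hs.2.eq_or_lt with h | h
    · rw [← h, Set.Icc_self]
      exact continuousWithinAt_singleton
    · obtain ⟨ε, hε, hle, k, hk⟩ := hf.exists_isAffineOn_right e hs.1 h
      have hc : ContinuousWithinAt (fun u => f (Γ.pt e s) + k * (u - s)) (Set.Icc s (Γ.len e)) s :=
        Continuous.continuousWithinAt (by fun_prop)
      refine hc.congr_of_eventuallyEq ?_ (by simp)
      filter_upwards [self_mem_nhdsWithin,
        mem_nhdsWithin_of_mem_nhds (Iio_mem_nhds (show s < s + ε by linarith))] with u hu hu'
      exact hk u ⟨hu.1, le_of_lt hu'⟩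
  have hleft : ContinuousWithinAt (fun u => f (Γ.pt e u)) (Set.Icc 0 s) s := by
    rcases hs.1.eq_or_lt with h | h
    · rw [← h, Set.Icc_self]
      exact continuousWithinAt_singleton
    · obtain ⟨ε, hε, hle, k, hk⟩ := hf.exists_isAffineOn_left e h hs.2
      have hc : ContinuousWithinAt (fun u => f (Γ.pt e (s - ε)) + k * (u - (s - ε)))
          (Set.Icc 0 s) s := Continuous.continuousWithinAt (by fun_prop)
      refine hc.congr_of_eventuallyEq ?_ (hk s ⟨by linarith, le_rfl⟩)
      filter_upwards [self_mem_nhdsWithin,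
        mem_nhdsWithin_of_mem_nhds (Ioi_mem_nhds (show s - ε < s by linarith))] with u hu hu'
      exact hk u ⟨le_of_lt hu', hu.2⟩
  rw [← Set.Icc_union_Icc_eq_Icc hs.1 hs.2]
  exact hleft.union hright

/-- Compactness of the finitely many closed edges; the bound makes the suprema defining normalized
coefficients finite. -/
theorem IsPL.exists_abs_le [Finite V] [Finite E] {f : Γ.Point → ℝ} (hf : IsPL f) :
    ∃ C : ℝ, ∀ x, |f x| ≤ C := by
  have he : ∀ e : E, ∃ C : ℝ, ∀ u ∈ Set.Icc 0 (Γ.len e), |f (Γ.pt e u)| ≤ C := fun e => by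
    obtain ⟨C, hC⟩ := isCompact_Icc.exists_bound_of_continuousOn (hf.continuousOn e)
    exact ⟨C, hC⟩
  choose C hC using he
  obtain ⟨A, hA⟩ := (Set.finite_range C).bddAbove
  obtain ⟨B, hB⟩ := (Set.finite_range fun v => |f (.vertex v)|).bddAbove
  refine ⟨max A B, ?_⟩
  rintro (v | ⟨e, t, h₀, h₁⟩)
  · exact (hB ⟨v, rfl⟩).trans (le_max_right _ _)
  · rw [← pt_of_mem_Ioo h₀ h₁]
    exact ((hC e t ⟨h₀.le, h₁.le⟩).trans (hA ⟨e, rfl⟩)).trans (le_max_left _ _)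

/-! ### The order at interior points -/

theorem tangentAt_interior {e : E} {s : ℝ} (h₀ : 0 < s) (h₁ : s < Γ.len e)
    (η : TangentAt (Γ.pt e s)) : η.1 = .fwd e s h₀.le h₁ ∨ η.1 = .bwd e s h₀ h₁.le := by
  obtain ⟨η, hη⟩ := η
  rw [pt_of_mem_Ioo h₀ h₁] at hη
  rcases η with ⟨e', s', h₀', h₁'⟩ | ⟨e', s', h₀', h₁'⟩
  · simp only [Tangent.base, Tangent.ray, add_zero] at hη
    obtain ⟨rfl, rfl⟩ := eq_of_pt_eq_interior hη
    exact Or.inl rfl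
  · simp only [Tangent.base, Tangent.ray, sub_zero] at hη
    obtain ⟨rfl, rfl⟩ := eq_of_pt_eq_interior hη
    exact Or.inr rfl

/-- The forward tangent vector as a tangent vector at a point. -/
def fwdAt (e : E) (s : ℝ) (h₀ : 0 ≤ s) (h₁ : s < Γ.len e) : TangentAt (Γ.pt e s) :=
  ⟨.fwd e s h₀ h₁, by simp [Tangent.base, Tangent.ray]⟩

/-- The backward tangent vector as a tangent vector at a point. -/
def bwdAt (e : E) (s : ℝ) (h₀ : 0 < s) (h₁ : s ≤ Γ.len e) : TangentAt (Γ.pt e s) :=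
  ⟨.bwd e s h₀ h₁, by simp [Tangent.base, Tangent.ray]⟩

theorem fwdAt_ne_bwdAt {e : E} {s : ℝ} (h₀ : 0 < s) (h₁ : s < Γ.len e) :
    fwdAt e s h₀.le h₁ ≠ bwdAt e s h₀ h₁.le := by
  intro h
  have := congrArg Subtype.val h
  simp [fwdAt, bwdAt] at this

theorem eq_fwdAt_or_eq_bwdAt {e : E} {s : ℝ} (h₀ : 0 < s) (h₁ : s < Γ.len e)
    (η : TangentAt (Γ.pt e s)) : η = fwdAt e s h₀.le h₁ ∨ η = bwdAt e s h₀ h₁.le :=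
  (tangentAt_interior h₀ h₁ η).imp (fun h => Subtype.ext h) fun h => Subtype.ext h

theorem ord_interior [Finite E] (f : Γ.Point → ℝ) {e : E} {s : ℝ} (h₀ : 0 < s)
    (h₁ : s < Γ.len e) :
    ord f (Γ.pt e s) = -(outSlope f (.fwd e s h₀.le h₁) + outSlope f (.bwd e s h₀ h₁.le)) := by
  classical
  have huniv : (Finset.univ : Finset (TangentAt (Γ.pt e s))) =
      {fwdAt e s h₀.le h₁, bwdAt e s h₀ h₁.le} := by
    ext η
    simpa using eq_fwdAt_or_eq_bwdAt h₀ h₁ η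
  rw [ord, huniv, Finset.sum_pair (fwdAt_ne_bwdAt h₀ h₁)]
  rfl

theorem valence_interior {e : E} {s : ℝ} (h₀ : 0 < s) (h₁ : s < Γ.len e) :
    valence (Γ.pt e s) = 2 := by
  classical
  have huniv : (Set.univ : Set (TangentAt (Γ.pt e s))) =
      {fwdAt e s h₀.le h₁, bwdAt e s h₀ h₁.le} := by
    ext η
    simpa using eq_fwdAt_or_eq_bwdAt h₀ h₁ η
  rw [valence, ← Set.ncard_univ, huniv, Set.ncard_pair (fwdAt_ne_bwdAt h₀ h₁)]

theorem ord_le_ord [Finite E] {f g : Γ.Point → ℝ} {v : Γ.Point}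
    (h : ∀ η : TangentAt v, outSlope f η.1 ≤ outSlope g η.1) : ord g v ≤ ord f v :=
  neg_le_neg (Finset.sum_le_sum fun η _ => h η)

theorem ord_lt_ord [Finite E] {f g : Γ.Point → ℝ} {v : Γ.Point}
    (h : ∀ η : TangentAt v, outSlope f η.1 ≤ outSlope g η.1)
    (h' : ∃ η : TangentAt v, outSlope f η.1 < outSlope g η.1) : ord g v < ord f v := by
  obtain ⟨η, hη⟩ := h'
  exact neg_lt_neg (Finset.sum_lt_sum (fun η _ => h η) ⟨η, Finset.mem_univ _, hη⟩)

end MetricGraph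

namespace MetricGraph

open Filter Topology

variable {V E : Type*} {Γ : MetricGraph V E} {ι : Type*}

/-! ### Tropical linear combinations of a family -/

/-- `f` is the tropical linear combination of the family `g` with coefficients `a`. -/
structure IsTropComb (g : ι → Γ.Point → ℝ) (a : ι → ℝ) (f : Γ.Point → ℝ) : Prop where
  le : ∀ i x, f x ≤ g i x + a i
  exists_eq : ∀ x, ∃ i, f x = g i x + a i

theorem isTropComb_tropicalCombination {n : ℕ} (f : Fin (n + 1) → Γ.Point → ℝ)
    (a : Fin (n + 1) → ℝ) : IsTropComb f a (tropicalCombination f a) where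
  le i x := Finset.inf'_le _ (Finset.mem_univ i)
  exists_eq x := by
    obtain ⟨i, -, hi⟩ := Finset.exists_mem_eq_inf' (Finset.univ_nonempty (α := Fin (n + 1)))
      fun i => f i x + a i
    exact ⟨i, hi⟩

theorem IsTropicalSubmodule.exists_isTropComb [Finite ι] [Nonempty ι] {L : Set (Γ.Point → ℝ)}
    (hL : IsTropicalSubmodule L) {g : ι → Γ.Point → ℝ} (hg : ∀ i, g i ∈ L) (a : ι → ℝ) :
    ∃ f ∈ L, IsTropComb g a f := by
  obtain ⟨n, ⟨e⟩⟩ := Finite.exists_equiv_fin ι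
  obtain ⟨n, rfl⟩ : ∃ m, n = m + 1 := by
    refine Nat.exists_eq_succ_of_ne_zero ?_
    rintro rfl
    exact (e (Classical.arbitrary ι)).elim0
  refine ⟨_, hL n (g ∘ e.symm) (a ∘ e.symm) fun i => hg _, fun i x => ?_, fun x => ?_⟩
  · have := (isTropComb_tropicalCombination (g ∘ e.symm) (a ∘ e.symm)).le (e i) x
    simpa using this
  · obtain ⟨i, hi⟩ := (isTropComb_tropicalCombination (g ∘ e.symm) (a ∘ e.symm)).exists_eq x
    exact ⟨e.symm i, hi⟩

theorem IsTropComb.ext {g : ι → Γ.Point → ℝ} {a : ι → ℝ} {f f' : Γ.Point → ℝ}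
    (hf : IsTropComb g a f) (hf' : IsTropComb g a f') : f = f' := by
  funext x
  obtain ⟨i, hi⟩ := hf.exists_eq x
  obtain ⟨j, hj⟩ := hf'.exists_eq x
  linarith [hf.le j x, hf'.le i x]

theorem IsTropicalSubmodule.isTropComb_mem [Finite ι] [Nonempty ι] {L : Set (Γ.Point → ℝ)}
    (hL : IsTropicalSubmodule L) {g : ι → Γ.Point → ℝ} (hg : ∀ i, g i ∈ L) {a : ι → ℝ}
    {f : Γ.Point → ℝ} (hf : IsTropComb g a f) : f ∈ L := by
  obtain ⟨f', hf', h⟩ := hL.exists_isTropComb hg a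
  rwa [hf.ext h]

theorem IsTropComb.outSlope_le {g : ι → Γ.Point → ℝ} {a : ι → ℝ} {f : Γ.Point → ℝ}
    (h : IsTropComb g a f) (hf : IsPL f) {η : Γ.Tangent} {i : ι} {k : ℤ}
    (hk : HasSlope (g i) η k) (hi : f η.base = g i η.base + a i) : outSlope f η ≤ k := by
  by_contra! hlt
  obtain ⟨t, ht⟩ := (hk.eventually_lt (hf.hasSlope η) (a := a i) (b := 0)
    (Or.inr ⟨by linarith, hlt⟩)).exists
  linarith [h.le i (η.ray t)]

/-- If every term attaining the minimum at the base had slope above that of `f`, no term could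
attain it just beyond the base. -/
theorem IsTropComb.exists_outSlope_eq [Finite ι] {g : ι → Γ.Point → ℝ} {a : ι → ℝ}
    {f : Γ.Point → ℝ} (h : IsTropComb g a f) (hf : IsPL f) {η : Γ.Tangent} {k : ι → ℤ}
    (hk : ∀ i, HasSlope (g i) η (k i)) :
    ∃ i, f η.base = g i η.base + a i ∧ outSlope f η = k i := by
  by_contra! hcon
  have hev : ∀ᶠ t in 𝓝[>] (0 : ℝ), ∀ i, f (η.ray t) + 0 < g i (η.ray t) + a i := by
    rw [eventually_all]
    intro i
    refine (hf.hasSlope η).eventually_lt (hk i) ?_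
    rcases (h.le i η.base).eq_or_lt with he | hlt
    · exact Or.inr ⟨by linarith, lt_of_le_of_ne (h.outSlope_le hf (hk i) he) (hcon i he)⟩
    · exact Or.inl (by linarith)
  obtain ⟨t, ht⟩ := hev.exists
  obtain ⟨i, hi⟩ := h.exists_eq (η.ray t)
  linarith [ht i]

/-- Tropical dependence, locally at a point: among the functions that attain the minimum at `v`,
the minimal outgoing slope is attained at least twice along each tangent vector. -/
theorem TropicallyDependent.exists_finset {n : ℕ} {f : Fin n → Γ.Point → ℝ}
    (h : TropicallyDependent f) (hf : ∀ i, IsPL (f i)) (v : Γ.Point) :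
    ∃ I : Finset (Fin n), (∃ i ∈ I, ∃ j ∈ I, i < j) ∧ ∀ η : TangentAt v, ∀ i ∈ I,
      (∀ j ∈ I, outSlope (f i) η.1 ≤ outSlope (f j) η.1) →
      ∃ j ∈ I, j ≠ i ∧ outSlope (f j) η.1 = outSlope (f i) η.1 := by
  classical
  obtain ⟨a, ha⟩ := h
  refine ⟨Finset.univ.filter fun i => ∀ j, f i v + a i ≤ f j v + a j, ?_, ?_⟩
  · obtain ⟨i, j, hij, he, hle⟩ := ha v
    have hi : i ∈ Finset.univ.filter fun i => ∀ j, f i v + a i ≤ f j v + a j := by simpa using hle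
    have hj : j ∈ Finset.univ.filter fun i => ∀ j, f i v + a i ≤ f j v + a j := by
      simpa [← he] using hle
    rcases lt_or_gt_of_ne hij with hlt | hlt
    exacts [⟨i, hi, j, hj, hlt⟩, ⟨j, hj, i, hi, hlt⟩]
  · rintro ⟨η, rfl⟩ i hi hmin
    simp only [Finset.mem_filter, Finset.mem_univ, true_and] at hi hmin ⊢
    by_contra! hcon
    -- Were the minimal slope attained only by `i`, the term `i` alone would attain the minimum just
    -- beyond the base.
    have hev : ∀ᶠ t in 𝓝[>] (0 : ℝ), ∀ j, j ≠ i → f i (η.ray t) + a i < f j (η.ray t) + a j := by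
      rw [eventually_all]
      intro j
      by_cases hji : j = i
      · exact Eventually.of_forall fun t hne => (hne hji).elim
      have : ∀ᶠ t in 𝓝[>] (0 : ℝ), f i (η.ray t) + a i < f j (η.ray t) + a j := by
        refine ((hf i).hasSlope η).eventually_lt ((hf j).hasSlope η) ?_
        rcases (hi j).eq_or_lt with he | hlt
        · have hj : ∀ l, f j η.base + a j ≤ f l η.base + a l := fun l => he ▸ hi l
          exact Or.inr ⟨he, lt_of_le_of_ne (hmin j hj) (hcon j hj hji).symm⟩
        · exact Or.inl hlt
      exact this.mono fun t ht _ => ht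
    obtain ⟨t, ht⟩ := hev.exists
    obtain ⟨p, q, hpq, he, hle⟩ := ha (η.ray t)
    by_cases hp : p = i
    · subst hp
      linarith [ht q hpq.symm]
    · linarith [ht p hp, hle i]

/-! ### Normalized coefficients -/

/-- A function that is, up to an arbitrarily small error at every point, bounded by and equal to a
translate of some member of a finite family, is a tropical linear combination of the family, with
its largest admissible coefficients. -/
theorem isTropComb_iSup [Finite ι] {g : ι → Γ.Point → ℝ} {f : Γ.Point → ℝ}
    (hb : ∀ i, BddAbove (Set.range fun x => f x - g i x))
    (h : ∀ x, ∀ ε : ℝ, 0 < ε → ∃ i c, (∀ y, f y ≤ g i y + c) ∧ g i x + c ≤ f x + ε) :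
    IsTropComb g (fun i => ⨆ x, (f x - g i x)) f where
  le i x := by linarith [le_ciSup (hb i) x]
  exists_eq x := by
    have : Nonempty Γ.Point := ⟨x⟩
    by_contra! hcon
    have hlt : ∀ i, f x < g i x + ⨆ x, (f x - g i x) := fun i =>
      lt_of_le_of_ne (by linarith [le_ciSup (hb i) x]) (hcon i)
    -- Finitely many positive gaps leave a common `ε`. The term `i` supplied for this `ε` has
    -- constant at least the supremum, a contradiction.
    have hev : ∀ᶠ ε in 𝓝[>] (0 : ℝ), ∀ i, f x + ε < g i x + ⨆ x, (f x - g i x) := by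
      rw [eventually_all]
      intro i
      filter_upwards [Ioo_mem_nhdsGT (sub_pos.2 (hlt i))] with ε hε
      linarith [hε.2]
    obtain ⟨ε, hε, hpos⟩ := (hev.and self_mem_nhdsWithin).exists
    obtain ⟨i, c, hc, hx⟩ := h x ε hpos
    have : ⨆ x, (f x - g i x) ≤ c := ciSup_le fun y => by linarith [hc y]
    linarith [hε i]

/-- `L` is the tropical span of the finite family `g`, and the coefficients can be taken in a
bounded set up to a common translation. -/
structure IsBoundedlyGenerated (L : Set (Γ.Point → ℝ)) (g : ι → Γ.Point → ℝ) (C : ℝ) : Prop where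
  mem : ∀ i, g i ∈ L
  exists_isTropComb : ∀ f ∈ L, ∃ a, IsTropComb g a f ∧ ∀ i j, a i - a j ≤ C

theorem subset_tropicalSpan (G : Set (Γ.Point → ℝ)) : G ⊆ tropicalSpan G := by
  intro g hg
  refine ⟨0, fun _ => g, fun _ => 0, fun _ => hg, ?_⟩
  funext x
  obtain ⟨i, hi⟩ := (isTropComb_tropicalCombination (fun _ : Fin 1 => g) fun _ => 0).exists_eq x
  rw [hi, add_zero]

theorem exists_bound_sub {G : Set (Γ.Point → ℝ)} (hG : G.Finite)
    (hb : ∀ g ∈ G, ∃ C : ℝ, ∀ x, |g x| ≤ C) :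
    ∃ C : ℝ, ∀ g ∈ G, ∀ g' ∈ G, ∀ x, g x - g' x ≤ C := by
  choose! B hB using hb
  obtain ⟨A, hA⟩ := (hG.image B).bddAbove
  refine ⟨A + A, fun g hg g' hg' x => ?_⟩
  have h₁ := (hB g hg x).trans (hA ⟨g, hg, rfl⟩)
  have h₂ := (hB g' hg' x).trans (hA ⟨g', hg', rfl⟩)
  linarith [le_abs_self (g x), neg_abs_le (g' x)]

/-- For the largest admissible coefficients `aᵢ = sup (f - gᵢ)` one has `aᵢ - aⱼ ≤ sup (gⱼ - gᵢ)`, a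
bound independent of `f`. This supplies the compactness for limits in `L`. -/
theorem exists_isBoundedlyGenerated [Nonempty Γ.Point] {G : Set (Γ.Point → ℝ)} (hG : G.Finite)
    (hb : ∀ g ∈ G, ∃ C : ℝ, ∀ x, |g x| ≤ C) :
    ∃ C, IsBoundedlyGenerated (tropicalSpan G) (Subtype.val : G → Γ.Point → ℝ) C := by
  obtain ⟨C, hC⟩ := exists_bound_sub hG hb
  have := hG.to_subtype
  refine ⟨C, fun i => subset_tropicalSpan G i.2, ?_⟩
  rintro f ⟨n, h, c, hmem, rfl⟩
  have hcomb := isTropComb_tropicalCombination h c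
  have hbdd : ∀ i : G, BddAbove (Set.range fun x => tropicalCombination h c x - i.1 x) := by
    rintro i
    refine ⟨C + c 0, ?_⟩
    rintro _ ⟨x, rfl⟩
    have h₁ := hC _ (hmem 0) _ i.2 x
    have h₂ := hcomb.le 0 x
    simp only
    linarith
  refine ⟨_, isTropComb_iSup hbdd fun x ε hε => ?_, fun i j => ?_⟩
  · obtain ⟨m, hm⟩ := hcomb.exists_eq x
    exact ⟨⟨h m, hmem m⟩, c m, hcomb.le m, by simp only; linarith⟩
  · rw [sub_le_iff_le_add]
    refine ciSup_le fun x => ?_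
    linarith [le_ciSup (hbdd j) x, hC _ j.2 _ i.2 x]

/-- A finitely generated tropical submodule of bounded functions is closed. -/
theorem isClosedInPL_tropicalSpan {G : Set (Γ.Point → ℝ)} (hG : G.Finite)
    (hb : ∀ g ∈ G, ∃ C : ℝ, ∀ x, |g x| ≤ C) (hsub : IsTropicalSubmodule (tropicalSpan G)) :
    IsClosedInPL (tropicalSpan G) := by
  intro f _ hf
  obtain ⟨C, hC⟩ := exists_bound_sub hG hb
  have := hG.to_subtype
  obtain ⟨f₁, ⟨n, h, c, hmem, rfl⟩, hf₁⟩ := hf 1 one_pos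
  have : Nonempty G := ⟨⟨h 0, hmem 0⟩⟩
  refine hsub.isTropComb_mem (g := (Subtype.val : G → Γ.Point → ℝ))
    (fun i => subset_tropicalSpan G i.2) (isTropComb_iSup (fun i => ?_) fun x ε hε => ?_)
  · refine ⟨C + c 0 + 1, ?_⟩
    rintro _ ⟨x, rfl⟩
    have h₁ := hC _ (hmem 0) _ i.2 x
    have h₂ := (isTropComb_tropicalCombination h c).le 0 x
    have h₃ := (abs_lt.1 (hf₁ x)).2
    simp only
    linarith
  · obtain ⟨_, ⟨n, h, c, hmem, rfl⟩, hf'⟩ := hf (ε / 2) (half_pos hε)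
    have hcomb := isTropComb_tropicalCombination h c
    obtain ⟨m, hm⟩ := hcomb.exists_eq x
    -- Raising the approximant by `ε / 2` puts it above `f` everywhere, and it exceeds `f` at `x` by
    -- at most `ε`.
    refine ⟨⟨h m, hmem m⟩, c m + ε / 2, fun y => ?_, ?_⟩
    · have h₁ := (abs_lt.1 (hf' y)).2
      have h₂ := hcomb.le m y
      simp only
      linarith
    · have h₁ := (abs_lt.1 (hf' x)).1
      simp only
      linarith

end MetricGraph

namespace MetricGraph

open Filter Topology

variable {V E : Type*} {Γ : MetricGraph V E} {ι : Type*}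

/-! ### Chips near a point -/

theorem IsAffineOn.mono {f : Γ.Point → ℝ} {e : E} {s t s' t' : ℝ} {k : ℤ}
    (h : IsAffineOn f e s t k) (hs : s ≤ s') (ht : t' ≤ t) : IsAffineOn f e s' t' k :=
  fun _ hu => h.apply_sub ⟨hs, (hu.1.trans hu.2).trans ht⟩ ⟨hs.trans hu.1, hu.2.trans ht⟩

/-- Positive order at an interior point is a slope drop: `i` carries the slope of `f` to the right
and `j` that to the left. -/
theorem IsTropComb.exists_lt_of_ord_pos [Finite E] [Finite ι] {g : ι → Γ.Point → ℝ} {a : ι → ℝ}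
    {f : Γ.Point → ℝ} (h : IsTropComb g a f) (hf : IsPL f) {e : E} {s t u : ℝ} (h₀ : 0 < u)
    (h₁ : u < Γ.len e) (hu : u ∈ Set.Ioo s t) {k : ι → ℤ}
    (hk : ∀ i, IsAffineOn (g i) e s t (k i)) (hord : 1 ≤ ord f (Γ.pt e u)) :
    ∃ i j, f (Γ.pt e u) = g i (Γ.pt e u) + a i ∧ f (Γ.pt e u) = g j (Γ.pt e u) + a j ∧
      k i < k j := by
  rw [ord_interior f h₀ h₁] at hord
  obtain ⟨i, hi, hi'⟩ := h.exists_outSlope_eq hf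
    fun i => (hk i).hasSlope_fwd ⟨hu.1.le, hu.2⟩ h₀.le h₁
  obtain ⟨j, hj, hj'⟩ := h.exists_outSlope_eq hf
    fun i => (hk i).hasSlope_bwd ⟨hu.1, hu.2.le⟩ h₀ h₁.le
  have hbf : (Tangent.fwd e u h₀.le h₁).base = Γ.pt e u := (fwdAt e u h₀.le h₁).2
  have hbb : (Tangent.bwd e u h₀ h₁.le).base = Γ.pt e u := (bwdAt e u h₀ h₁.le).2
  rw [hbf] at hi
  rw [hbb] at hj
  exact ⟨i, j, hi, hj, by omega⟩

/-- The family `g` is affine on the initial piece of length `ε` of `η`, and any tropical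
combination of `g` whose divisor, added to `D`, has a chip in the interior of this piece has two
different slopes there. -/
structure IsTestLength [Finite E] (g : ι → Γ.Point → ℝ) (D : Γ.Divisor) (η : Γ.Tangent)
    (ε : ℝ) : Prop where
  pos : 0 < ε
  apply_ray : ∀ i, ∀ t ∈ Set.Icc 0 ε, g i (η.ray t) = g i η.base + outSlope (g i) η * t
  exists_lt : ∀ t ∈ Set.Ioo 0 ε, ∀ f a, IsTropComb g a f → IsPL f →
    1 ≤ ord f (η.ray t) + D (η.ray t) → ∃ i j, f (η.ray t) = g i (η.ray t) + a i ∧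
      f (η.ray t) = g j (η.ray t) + a j ∧ outSlope (g i) η < outSlope (g j) η

/-- The position of a point on its edge. -/
def Point.position : Γ.Point → ℝ
  | .vertex _ => 0
  | .interior _ t _ _ => t

theorem exists_pos_forall_apply_eq_zero (D : Γ.Divisor) (e : E) (s : ℝ) :
    ∃ ε : ℝ, 0 < ε ∧ ∀ u, 0 < u → u < Γ.len e →
      u ∈ Set.Ioo s (s + ε) ∨ u ∈ Set.Ioo (s - ε) s → D (Γ.pt e u) = 0 := by
  classical
  -- Positions on other edges, and the value `0` of vertices, are avoided too, which is harmless.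
  obtain ⟨ε, hε, h⟩ := exists_pos_forall_notMem (D.support.image Point.position) s
  refine ⟨ε, hε, fun u h₀ h₁ hu => ?_⟩
  by_contra hne
  have hmem : u ∈ D.support.image Point.position := by
    rw [Finset.mem_image]
    exact ⟨_, Finsupp.mem_support_iff.2 hne, by rw [pt_of_mem_Ioo h₀ h₁]; rfl⟩
  rcases hu with hu | hu
  exacts [(h u hmem).1 hu, (h u hmem).2 hu]

theorem exists_forall_le_pos [Finite ι] {ε : ι → ℝ} (h : ∀ i, 0 < ε i) {δ : ℝ} (hδ : 0 < δ) :
    ∃ ε' : ℝ, 0 < ε' ∧ ε' ≤ δ ∧ ∀ i, ε' ≤ ε i := by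
  have hev : ∀ᶠ x in 𝓝[>] (0 : ℝ), ∀ i, x ≤ ε i := by
    rw [eventually_all]
    intro i
    filter_upwards [Ioo_mem_nhdsGT (h i)] with x hx
    exact hx.2.le
  obtain ⟨x, ⟨h₁, h₂⟩, h₃⟩ := ((hev.and (Ioo_mem_nhdsGT hδ)).and self_mem_nhdsWithin).exists
  exact ⟨x, h₃, h₂.2.le, h₁⟩

theorem exists_isTestLength [Finite E] [Finite ι] {g : ι → Γ.Point → ℝ} (hg : ∀ i, IsPL (g i))
    (D : Γ.Divisor) (η : Γ.Tangent) : ∃ ε, IsTestLength g D η ε := by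
  rcases η with ⟨e, s, h₀, h₁⟩ | ⟨e, s, h₀, h₁⟩
  · choose ε' hε' hle k hk using fun i => (hg i).exists_isAffineOn_right e h₀ h₁
    obtain ⟨δ, hδ, hD⟩ := exists_pos_forall_apply_eq_zero D e s
    obtain ⟨ε, hε, hεδ, hεε'⟩ :=
      exists_forall_le_pos hε' (lt_min hδ (sub_pos.2 h₁))
    have hk' : ∀ i, IsAffineOn (g i) e s (s + ε) (k i) := fun i =>
      (hk i).mono le_rfl (by linarith [hεε' i])
    have hsl : ∀ i, outSlope (g i) (.fwd e s h₀ h₁) = k i := fun i =>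
      ((hk' i).hasSlope_fwd ⟨le_rfl, by linarith⟩ h₀ h₁).outSlope_eq
    have hε₁ := hεδ.trans (min_le_left _ _)
    have hε₂ := hεδ.trans (min_le_right _ _)
    refine ⟨ε, hε, fun i t ht => ?_, fun t ht f a hf hPL hord => ?_⟩
    · rw [hsl]
      simp only [Tangent.base, Tangent.ray, add_zero]
      rw [hk' i (s + t) ⟨by linarith [ht.1], by linarith [ht.2]⟩]
      ring
    · simp only [hsl]
      simp only [Tangent.ray] at hord ⊢
      have hu₀ : 0 < s + t := by linarith [ht.1]
      have hu₁ : s + t < Γ.len e := by linarith [ht.2]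
      rw [hD _ hu₀ hu₁ (Or.inl ⟨by linarith [ht.1], by linarith [ht.2]⟩), add_zero] at hord
      exact hf.exists_lt_of_ord_pos hPL hu₀ hu₁ ⟨by linarith [ht.1], by linarith [ht.2]⟩ hk' hord
  · choose ε' hε' hle k hk using fun i => (hg i).exists_isAffineOn_left e h₀ h₁
    obtain ⟨δ, hδ, hD⟩ := exists_pos_forall_apply_eq_zero D e s
    obtain ⟨ε, hε, hεδ, hεε'⟩ := exists_forall_le_pos hε' (lt_min hδ h₀)
    have hk' : ∀ i, IsAffineOn (g i) e (s - ε) s (k i) := fun i =>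
      (hk i).mono (by linarith [hεε' i]) le_rfl
    have hsl : ∀ i, outSlope (g i) (.bwd e s h₀ h₁) = -k i := fun i =>
      ((hk' i).hasSlope_bwd ⟨by linarith, le_rfl⟩ h₀ h₁).outSlope_eq
    have hε₁ := hεδ.trans (min_le_left _ _)
    have hε₂ := hεδ.trans (min_le_right _ _)
    refine ⟨ε, hε, fun i t ht => ?_, fun t ht f a hf hPL hord => ?_⟩
    · rw [hsl]
      simp only [Tangent.base, Tangent.ray, sub_zero]
      rw [(hk' i).apply_sub (u := s) ⟨by linarith, le_rfl⟩
        ⟨by linarith [ht.2], by linarith [ht.1]⟩]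
      push_cast
      ring
    · simp only [hsl]
      simp only [Tangent.ray] at hord ⊢
      have hu₀ : 0 < s - t := by linarith [ht.2]
      have hu₁ : s - t < Γ.len e := by linarith [ht.1]
      rw [hD _ hu₀ hu₁ (Or.inr ⟨by linarith [ht.2], by linarith [ht.1]⟩), add_zero] at hord
      obtain ⟨i, j, hi, hj, hij⟩ :=
        hf.exists_lt_of_ord_pos hPL hu₀ hu₁ ⟨by linarith [ht.2], by linarith [ht.1]⟩ hk' hord
      -- Along a backward vector the slopes change sign, so the two terms swap roles.
      exact ⟨j, i, hj, hi, neg_lt_neg hij⟩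

/-- Moving along a tangent vector, the slopes of the terms that attain the minimum decrease. -/
theorem IsTestLength.outSlope_le [Finite E] {g : ι → Γ.Point → ℝ} {D : Γ.Divisor} {η : Γ.Tangent}
    {ε : ℝ} (h : IsTestLength g D η ε) {f : Γ.Point → ℝ} {a : ι → ℝ} (hf : IsTropComb g a f)
    {t t' : ℝ} (h₀ : 0 ≤ t) (hlt : t < t') (h₁ : t' ≤ ε) {i j : ι}
    (hi : f (η.ray t) = g i (η.ray t) + a i) (hj : f (η.ray t') = g j (η.ray t') + a j) :
    outSlope (g j) η ≤ outSlope (g i) η := by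
  have e₁ := hf.le j (η.ray t)
  have e₂ := hf.le i (η.ray t')
  rw [hi, h.apply_ray i t ⟨h₀, hlt.le.trans h₁⟩, h.apply_ray j t ⟨h₀, hlt.le.trans h₁⟩] at e₁
  rw [hj, h.apply_ray i t' ⟨h₀.trans hlt.le, h₁⟩, h.apply_ray j t' ⟨h₀.trans hlt.le, h₁⟩] at e₂
  by_contra! hcon
  have hcon' : (outSlope (g i) η : ℝ) < outSlope (g j) η := by exact_mod_cast hcon
  nlinarith

theorem IsTestLength.outSlope_le_of_comb [Finite E] [Finite ι] {g : ι → Γ.Point → ℝ}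
    {D : Γ.Divisor} {η : Γ.Tangent} {ε : ℝ} (h : IsTestLength g D η ε) (hg : ∀ i, IsPL (g i))
    {f : Γ.Point → ℝ} {a : ι → ℝ} (hf : IsTropComb g a f) (hPL : IsPL f) {t : ℝ} (h₀ : 0 < t)
    (h₁ : t ≤ ε) {j : ι} (hj : f (η.ray t) = g j (η.ray t) + a j) :
    outSlope (g j) η ≤ outSlope f η := by
  obtain ⟨i, hi, hi'⟩ := hf.exists_outSlope_eq hPL fun i => (hg i).hasSlope η
  rw [hi']
  exact h.outSlope_le hf le_rfl h₀ h₁ hi hj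

/-! ### Degrees and sets of slopes -/

theorem Divisor.deg_add (D D' : Γ.Divisor) : Divisor.deg (D + D') = D.deg + D'.deg :=
  Finsupp.sum_add_index' (fun _ => rfl) fun _ _ _ => rfl

theorem Divisor.deg_single (p : Γ.Point) (n : ℤ) :
    Divisor.deg (Finsupp.single p n) = n := Finsupp.sum_single_index rfl

theorem Divisor.deg_sum (s : Finset ι) (F : ι → Γ.Divisor) :
    Divisor.deg (∑ i ∈ s, F i) = ∑ i ∈ s, (F i).deg := by
  classical
  induction s using Finset.induction_on with
  | empty => simp [Divisor.deg]
  | insert i s hi ih => rw [Finset.sum_insert hi, Finset.sum_insert hi, Divisor.deg_add, ih]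

/-- The set of outgoing slopes of the functions in `L` along `η`. -/
def slopeSet (L : Set (Γ.Point → ℝ)) (η : Γ.Tangent) : Set ℤ := (fun f => outSlope f η) '' L

theorem IsBoundedlyGenerated.slopeSet_eq [Finite ι] {L : Set (Γ.Point → ℝ)}
    {g : ι → Γ.Point → ℝ} {C : ℝ} (hg : IsBoundedlyGenerated L g C)
    (hPL : ∀ f ∈ L, IsPL f) (η : Γ.Tangent) :
    slopeSet L η = Set.range fun i => outSlope (g i) η := by
  refine Set.Subset.antisymm ?_ ?_
  · rintro _ ⟨f, hf, rfl⟩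
    obtain ⟨a, ha, -⟩ := hg.exists_isTropComb f hf
    obtain ⟨i, -, hi⟩ := ha.exists_outSlope_eq (hPL f hf) fun i => (hPL _ (hg.mem i)).hasSlope η
    exact ⟨i, hi.symm⟩
  · rintro _ ⟨i, rfl⟩
    exact ⟨g i, hg.mem i, rfl⟩

/-! ### Tropical linear series -/

variable [Finite E] {r : ℕ} {D : Γ.Divisor} {L : Set (Γ.Point → ℝ)}

theorem IsTropicalLinearSeries.isPL (hL : IsTropicalLinearSeries r D L) {f : Γ.Point → ℝ}
    (hf : f ∈ L) : IsPL f := (hL.subset hf).1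

theorem IsTropicalLinearSeries.exists_chips (hL : IsTropicalLinearSeries r D L)
    (p : Fin r → Γ.Point) : ∃ f ∈ L, ∀ m, 1 ≤ ord f (p m) + D (p m) := by
  classical
  have hpos : ∀ i : Fin r, (0 : Γ.Divisor) ≤ Finsupp.single (p i) 1 := fun i =>
    Finsupp.single_nonneg.2 zero_le_one
  obtain ⟨f, hf, h⟩ := hL.bakerNorine (∑ m, Finsupp.single (p m) 1)
    (Finset.sum_nonneg fun i _ => hpos i)
    (by simp [Divisor.deg_sum, Divisor.deg_single])
  refine ⟨f, hf, fun m => le_trans ?_ (h (p m))⟩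
  have := (Finset.single_le_sum (fun i _ => hpos i) (Finset.mem_univ m) :
    Finsupp.single (p m) (1 : ℤ) ≤ _) (p m)
  rwa [Finsupp.single_eq_same] at this

theorem IsTropicalLinearSeries.nonempty (hL : IsTropicalLinearSeries r D L)
    (p : Γ.Point) : L.Nonempty := by
  obtain ⟨f, hf, -⟩ := hL.exists_chips fun _ => p
  exact ⟨f, hf⟩

/-- A function with `r` chips at distinct points inside a test piece drops slope at each of them, so
it runs through `r + 1` slopes. -/
theorem IsTropicalLinearSeries.lt_ncard_slopeSet [Finite ι] (hL : IsTropicalLinearSeries r D L)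
    {g : ι → Γ.Point → ℝ} {C : ℝ} (hg : IsBoundedlyGenerated L g C) (η : Γ.Tangent) :
    r + 1 ≤ (slopeSet L η).ncard := by
  have hgPL : ∀ i, IsPL (g i) := fun i => hL.isPL (hg.mem i)
  obtain ⟨ε, hε⟩ := exists_isTestLength hgPL D η
  let t : Fin r → ℝ := fun m => ε * ((m + 1 : ℝ) / (r + 1))
  have hr : (0 : ℝ) < r + 1 := by positivity
  have hmono : ∀ m n : Fin r, m < n → t m < t n := fun m n hmn => by
    have : ((m : ℕ) : ℝ) < (n : ℕ) := by exact_mod_cast hmn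
    simp only [t]
    gcongr
    exact hε.pos
  have ht : ∀ m, t m ∈ Set.Ioo 0 ε := fun m => by
    refine ⟨mul_pos hε.pos (by positivity), ?_⟩
    have : ((m : ℕ) : ℝ) < r := by exact_mod_cast m.2
    have : ((m : ℕ) + 1 : ℝ) / (r + 1) < 1 := by
      rw [div_lt_one hr]
      linarith
    simpa only [mul_one] using mul_lt_mul_of_pos_left this hε.pos
  obtain ⟨f, hf, hchip⟩ := hL.exists_chips fun m => η.ray (t m)
  obtain ⟨a, ha, -⟩ := hg.exists_isTropComb f hf
  choose i j hi hj hij using fun m => hε.exists_lt (t m) (ht m) f a ha (hL.isPL hf) (hchip m)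
  -- The slope at the base, followed by the smaller of the two slopes found at each chip.
  let c : Fin (r + 1) → ℤ := Fin.cons (outSlope f η) fun m => outSlope (g (i m)) η
  have hc : StrictAnti c := by
    have : ∀ m n : Fin r, m < n → outSlope (g (i n)) η < outSlope (g (i m)) η := fun m n hmn =>
      (hij n).trans_le (hε.outSlope_le ha (ht m).1.le (hmono m n hmn) (ht n).2.le (hi m) (hj n))
    have h₀ : ∀ n : Fin r, outSlope (g (i n)) η < outSlope f η := fun n =>
      (hij n).trans_le (hε.outSlope_le_of_comb hgPL ha (hL.isPL hf) (ht n).1 (ht n).2.le (hj n))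
    intro m n
    refine Fin.cases ?_ (fun m => ?_) m <;> refine Fin.cases ?_ (fun n => ?_) n
    · exact fun h => (lt_irrefl _ h).elim
    · exact fun _ => h₀ n
    · exact fun h => (Fin.not_lt_zero _ h).elim
    · exact fun h => this m n (Fin.succ_lt_succ_iff.1 h)
  have hsub : Set.range c ⊆ slopeSet L η := by
    rintro _ ⟨m, rfl⟩
    refine Fin.cases ?_ (fun m => ?_) m
    · exact ⟨f, hf, rfl⟩
    · exact ⟨_, hg.mem (i m), rfl⟩
  have hfin : (slopeSet L η).Finite := by
    rw [hg.slopeSet_eq (fun f hf => hL.isPL hf)]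
    exact Set.finite_range _
  refine le_trans (le_of_eq ?_) (Set.ncard_le_ncard hsub hfin)
  rw [← Set.image_univ, Set.ncard_image_of_injective _ hc.injective, Set.ncard_univ,
    Nat.card_eq_fintype_card, Fintype.card_fin]

/-- There are no `r + 2` functions in `L` such that, along suitable tangent vectors at `v`, the
slope of each function is smaller than the slopes of all functions from a given later one on. -/
theorem IsTropicalLinearSeries.not_outSlope_lt (hL : IsTropicalLinearSeries r D L) (v : Γ.Point)
    (f : Fin (r + 2) → Γ.Point → ℝ) (hf : ∀ i, f i ∈ L) :
    ¬ ∀ i j, i < j → ∃ η : TangentAt v, ∀ l, j ≤ l →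
      outSlope (f i) η.1 < outSlope (f l) η.1 := by
  classical
  intro h
  have hinj : Function.Injective f := by
    intro i j hij
    by_contra hne
    rcases lt_or_gt_of_ne hne with hlt | hlt
    · obtain ⟨η, hη⟩ := h i j hlt
      exact absurd (hη j le_rfl) (by rw [hij]; exact lt_irrefl _)
    · obtain ⟨η, hη⟩ := h j i hlt
      exact absurd (hη i le_rfl) (by rw [hij]; exact lt_irrefl _)
  obtain ⟨I, ⟨p, hp, q, hq, hpq⟩, hI⟩ :=
    (hL.dependent f hinj hf).exists_finset (fun i => hL.isPL (hf i)) v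
  have hne : I.Nonempty := ⟨p, hp⟩
  -- With `i` and `j` the two smallest indices in `I`, some tangent vector makes the slope of `f i`
  -- the strict minimum in `I`, while dependence requires it to occur twice.
  set i := I.min' hne with hi
  have hi_mem : i ∈ I := I.min'_mem hne
  have hne' : (I.erase i).Nonempty :=
    ⟨q, Finset.mem_erase.2 ⟨((I.min'_le p hp).trans_lt hpq).ne', hq⟩⟩
  set j := (I.erase i).min' hne' with hj
  have hj_mem := (I.erase i).min'_mem hne'
  rw [← hj, Finset.mem_erase] at hj_mem
  obtain ⟨η, hη⟩ := h i j (lt_of_le_of_ne (I.min'_le j hj_mem.2) hj_mem.1.symm)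
  have hlt : ∀ l ∈ I, l ≠ i → outSlope (f i) η.1 < outSlope (f l) η.1 := fun l hl hli =>
    hη l ((I.erase i).min'_le l (Finset.mem_erase.2 ⟨hli, hl⟩))
  obtain ⟨l, hl, hli, he⟩ := hI η i hi_mem fun l hl => by
    by_cases hli : l = i
    · rw [hli]
    · exact (hlt l hl hli).le
  exact (hlt l hl hli).ne' he

/-- Functions listed by increasing slope along `η` satisfy the condition excluded by
`not_outSlope_lt`, with the same `η` for all pairs. -/
theorem IsTropicalLinearSeries.ncard_slopeSet_le [Finite ι] (hL : IsTropicalLinearSeries r D L)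
    {g : ι → Γ.Point → ℝ} {C : ℝ} (hg : IsBoundedlyGenerated L g C) (η : Γ.Tangent) :
    (slopeSet L η).ncard ≤ r + 1 := by
  by_contra! hlt
  have hfin : (slopeSet L η).Finite := by
    rw [hg.slopeSet_eq (fun f hf => hL.isPL hf)]
    exact Set.finite_range _
  rw [Set.ncard_eq_toFinset_card _ hfin] at hlt
  let c := hfin.toFinset.orderEmbOfCardLe (k := r + 2) hlt
  have hc : ∀ m, c m ∈ slopeSet L η := fun m =>
    hfin.mem_toFinset.1 (Finset.orderEmbOfCardLe_mem _ hlt m)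
  choose f hf hfc using hc
  refine hL.not_outSlope_lt η.base f hf fun i j hij => ⟨⟨η, rfl⟩, fun l hl => ?_⟩
  have h : c i < c l := c.strictMono (hij.trans_le hl)
  rwa [← hfc i, ← hfc l] at h

/-- For tangent vectors `η₁, …, ηᵣ` there are two functions in `L` such that at the base of every
`ηₘ` the outgoing slopes of the first are at most those of the second, and less along `ηₘ`. -/
theorem IsTropicalLinearSeries.exists_outSlope_lt [Finite ι] [Nonempty ι]
    (hL : IsTropicalLinearSeries r D L) {g : ι → Γ.Point → ℝ} {C : ℝ}
    (hg : IsBoundedlyGenerated L g C) (η : Fin r → Γ.Tangent) :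
    ∃ f ∈ L, ∃ h ∈ L, ∀ m, (∀ ξ : TangentAt (η m).base, outSlope f ξ.1 ≤ outSlope h ξ.1) ∧
      outSlope f (η m) < outSlope h (η m) := by
  have hgPL : ∀ i, IsPL (g i) := fun i => hL.isPL (hg.mem i)
  choose ε hε using fun m => exists_isTestLength hgPL D (η m)
  -- The chips tend to the base points; the summand `2` keeps them strictly inside the test pieces
  -- already for `n = 0`.
  let t : ℕ → Fin r → ℝ := fun n m => ε m * (1 / ((n : ℝ) + 2))
  have ht : ∀ n m, t n m ∈ Set.Ioo 0 (ε m) := fun n m => by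
    have hn : (0 : ℝ) ≤ n := n.cast_nonneg
    have : 1 / ((n : ℝ) + 2) < 1 := by
      rw [div_lt_one (by positivity)]
      linarith
    exact ⟨mul_pos (hε m).pos (by positivity),
      by simpa only [mul_one] using mul_lt_mul_of_pos_left this (hε m).pos⟩
  have htlim : ∀ m, Tendsto (fun n => t n m) atTop (𝓝 0) := fun m => by
    have h₁ : Tendsto (fun n : ℕ => (n : ℝ) + 2) atTop atTop :=
      tendsto_atTop_add_const_right _ _ tendsto_natCast_atTop_atTop
    simpa [t] using (tendsto_inv_atTop_zero.comp h₁).const_mul (ε m)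
  choose F hF hchip using fun n => hL.exists_chips fun m => (η m).ray (t n m)
  choose a ha hab using fun n => hg.exists_isTropComb (F n) (hF n)
  let i₀ : ι := Classical.arbitrary ι
  -- Only differences of coefficients are bounded, so one coefficient is normalized to zero before
  -- extracting a limit.
  let b : ℕ → ι → ℝ := fun n i => a n i - a n i₀
  have hb : ∀ n, b n ∈ Set.univ.pi fun _ : ι => Set.Icc (-C) C := fun n i _ =>
    ⟨by linarith [hab n i₀ i], hab n i i₀⟩
  obtain ⟨b', -, φ, hφ, hlim⟩ :=
    (isCompact_univ_pi fun _ : ι => isCompact_Icc).tendsto_subseq hb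
  have hlim' : ∀ i, Tendsto (fun n => b (φ n) i) atTop (𝓝 (b' i)) := fun i =>
    (continuous_apply i).continuousAt.tendsto.comp hlim
  obtain ⟨f, hf, hcomb⟩ := hL.submodule.exists_isTropComb hg.mem b'
  -- The terms attaining the minimum near a point attain it at the point, in the limit
  have key : ∀ (x : ℕ → Γ.Point) (y : Γ.Point),
      (∀ i, Tendsto (fun n => g i (x n)) atTop (𝓝 (g i y))) →
      ∀ᶠ n in atTop, ∀ i, F (φ n) (x n) = g i (x n) + a (φ n) i → f y = g i y + b' i := by
    intro x y hx
    rw [eventually_all]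
    intro i
    rcases (hcomb.le i y).eq_or_lt with he | hlt
    · exact Eventually.of_forall fun _ _ => he
    obtain ⟨j, hj⟩ := hcomb.exists_eq y
    rw [hj] at hlt
    filter_upwards [((hx j).add (hlim' j)).eventually_lt ((hx i).add (hlim' i)) hlt] with n hn hi
    have := (ha (φ n)).le j (x n)
    simp only [b] at hn
    linarith
  have hray : ∀ m i, Tendsto (fun n => g i ((η m).ray (t (φ n) m))) atTop
      (𝓝 (g i (η m).base)) := fun m i => by
    have h₁ : Tendsto (fun n => g i (η m).base + outSlope (g i) (η m) * t (φ n) m) atTop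
        (𝓝 (g i (η m).base + outSlope (g i) (η m) * 0)) :=
      (((htlim m).comp hφ.tendsto_atTop).const_mul _).const_add _
    rw [mul_zero, add_zero] at h₁
    refine h₁.congr fun n => ((hε m).apply_ray i _ ?_).symm
    exact ⟨(ht (φ n) m).1.le, (ht (φ n) m).2.le⟩
  have hev : ∀ᶠ n in atTop, ∀ m i,
      (F (φ n) (η m).base = g i (η m).base + a (φ n) i →
        f (η m).base = g i (η m).base + b' i) ∧
      (F (φ n) ((η m).ray (t (φ n) m)) = g i ((η m).ray (t (φ n) m)) + a (φ n) i →
        f (η m).base = g i (η m).base + b' i) := by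
    rw [eventually_all]
    intro m
    filter_upwards [key (fun _ => (η m).base) _ fun i => tendsto_const_nhds,
      key _ _ (hray m)] with n h₁ h₂ i
    exact ⟨h₁ i, h₂ i⟩
  obtain ⟨n, hn⟩ := hev.exists
  have hFPL := hL.isPL (hF (φ n))
  refine ⟨f, hf, F (φ n), hF (φ n), fun m => ⟨?_, ?_⟩⟩
  -- The slope of `F (φ n)` is that of a term attaining its minimum at the base; this term attains
  -- the minimum of `f` there too and bounds its slope.
  · rintro ⟨ξ, hξ⟩
    obtain ⟨i, hi, hi'⟩ := (ha (φ n)).exists_outSlope_eq hFPL fun i => (hgPL i).hasSlope ξ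
    rw [hi']
    refine hcomb.outSlope_le (hL.isPL hf) ((hgPL i).hasSlope ξ) ?_
    rw [hξ] at hi ⊢
    exact (hn m i).1 hi
  -- Of the two terms meeting at the chip, the one of smaller slope bounds `f` from above and the
  -- other bounds `F (φ n)` from below.
  · obtain ⟨i, j, hi, hj, hij⟩ :=
      (hε m).exists_lt _ (ht (φ n) m) _ _ (ha (φ n)) hFPL (hchip (φ n) m)
    calc outSlope f (η m) ≤ outSlope (g i) (η m) :=
          hcomb.outSlope_le (hL.isPL hf) ((hgPL i).hasSlope _) ((hn m i).2 hi)
      _ < outSlope (g j) (η m) := hij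
      _ ≤ outSlope (F (φ n)) (η m) :=
          (hε m).outSlope_le_of_comb hgPL (ha (φ n)) hFPL (ht (φ n) m).1 (ht (φ n) m).2.le hj

end MetricGraph

namespace MetricGraph

variable {V E : Type*} {Γ : MetricGraph V E}

/-- Both `a` and `i ↦ -b i.rev` are increasing enumerations of one finite set, and such an
enumeration is unique. -/
theorem add_rev_eq_zero_of_range_eq_neg {n : ℕ} {a b : Fin n → ℤ} (ha : StrictMono a)
    (hb : StrictMono b) (h : Set.range b = Neg.neg '' Set.range a) (i : Fin n) :
    a i + b i.rev = 0 := by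
  have hb' : StrictMono fun i : Fin n => -b i.rev := fun i j hij =>
    neg_lt_neg (hb (Fin.rev_lt_rev.2 hij))
  have hr : Set.range (fun i : Fin n => -b i.rev) = Set.range a := by
    ext x
    constructor
    · rintro ⟨i, rfl⟩
      obtain ⟨_, ⟨j, rfl⟩, hj⟩ := h.subset ⟨i.rev, rfl⟩
      exact ⟨j, by simp only [← hj, neg_neg]⟩
    · rintro ⟨j, rfl⟩
      obtain ⟨i, hi⟩ := h.superset ⟨_, ⟨j, rfl⟩, rfl⟩
      exact ⟨i.rev, by simp only [Fin.rev_rev, hi, neg_neg]⟩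
  have := congrFun ((hb'.range_inj ha).1 hr) i
  omega

/-! ### Effective divisors -/

theorem Divisor.sum_le_deg {D : Γ.Divisor} (hD : 0 ≤ D) (s : Finset Γ.Point) :
    ∑ v ∈ s, D v ≤ D.deg := by
  classical
  have h : ∑ v ∈ s, D v ≤ ∑ v ∈ s ∪ D.support, D v :=
    Finset.sum_le_sum_of_subset_of_nonneg Finset.subset_union_left fun v _ _ => hD v
  refine h.trans (le_of_eq ?_)
  rw [Divisor.deg, Finsupp.sum]
  refine (Finset.sum_subset Finset.subset_union_right fun v _ hv => ?_).symm
  exact Finsupp.notMem_support_iff.1 hv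

theorem Divisor.le_deg {D : Γ.Divisor} (hD : 0 ≤ D) (v : Γ.Point) : D v ≤ D.deg := by
  simpa using D.sum_le_deg hD {v}

/-! ### The arrays of jumps of a tropical linear series -/

/-- `S` enumerates the slopes of the functions in `L` along every tangent vector. -/
structure IsSlopeEnumeration {r : ℕ} (L : Set (Γ.Point → ℝ)) (S : Γ.Tangent → Fin (r + 1) → ℤ) :
    Prop where
  strictMono : ∀ η, StrictMono (S η)
  range_eq : ∀ η, Set.range (S η) = slopeSet L η

/-- The set of the vectors of slope indices at `v` of the functions in `L`. -/
def jumpArray {r : ℕ} (L : Set (Γ.Point → ℝ)) (S : Γ.Tangent → Fin (r + 1) → ℤ) (v : Γ.Point) :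
    DotArray (TangentAt v) r :=
  {x | ∃ f ∈ L, ∀ η : TangentAt v, S η.1 (x η) = outSlope f η.1}

/-- All outgoing slopes of `f` at `v` are minimal among those of the functions in `L`. -/
def HasMinimalSlopes (L : Set (Γ.Point → ℝ)) (f : Γ.Point → ℝ) (v : Γ.Point) : Prop :=
  ∀ η : TangentAt v, ∀ h ∈ L, outSlope f η.1 ≤ outSlope h η.1

/-- Some function in `L` has larger vector of outgoing slopes at `v` than `f`. -/
def HasNonmaximalSlopes (L : Set (Γ.Point → ℝ)) (f : Γ.Point → ℝ) (v : Γ.Point) : Prop :=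
  ∃ h ∈ L, (∀ η : TangentAt v, outSlope f η.1 ≤ outSlope h η.1) ∧
    ∃ η : TangentAt v, outSlope f η.1 < outSlope h η.1

theorem IsSlopeEnumeration.exists_index {r : ℕ} {L : Set (Γ.Point → ℝ)}
    {S : Γ.Tangent → Fin (r + 1) → ℤ} (hS : IsSlopeEnumeration L S) {f : Γ.Point → ℝ} (hf : f ∈ L)
    (η : Γ.Tangent) : ∃ j, S η j = outSlope f η :=
  (hS.range_eq η).superset ⟨f, hf, rfl⟩

theorem IsSlopeEnumeration.exists_mem {r : ℕ} {L : Set (Γ.Point → ℝ)}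
    {S : Γ.Tangent → Fin (r + 1) → ℤ} (hS : IsSlopeEnumeration L S)
    (η : Γ.Tangent) (j : Fin (r + 1)) : ∃ f ∈ L, outSlope f η = S η j :=
  (hS.range_eq η).subset ⟨j, rfl⟩

theorem IsSlopeEnumeration.exists_jump {r : ℕ} {L : Set (Γ.Point → ℝ)}
    {S : Γ.Tangent → Fin (r + 1) → ℤ} (hS : IsSlopeEnumeration L S) {f : Γ.Point → ℝ} (hf : f ∈ L)
    (v : Γ.Point) :
    ∃ x : TangentAt v → Fin (r + 1), ∀ η : TangentAt v, S η.1 (x η) = outSlope f η.1 := by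
  choose x hx using fun η : TangentAt v => hS.exists_index hf η.1
  exact ⟨x, hx⟩

theorem IsSlopeEnumeration.exists_mem_jumpArray {r : ℕ} {L : Set (Γ.Point → ℝ)}
    {S : Γ.Tangent → Fin (r + 1) → ℤ} (hS : IsSlopeEnumeration L S) {v : Γ.Point}
    (η : TangentAt v) (j : Fin (r + 1)) : ∃ x ∈ jumpArray L S v, x η = j := by
  obtain ⟨f, hf, hfj⟩ := hS.exists_mem η.1 j
  obtain ⟨x, hx⟩ := hS.exists_jump hf v
  exact ⟨x, ⟨f, hf, hx⟩, (hS.strictMono η.1).injective ((hx η).trans hfj)⟩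

theorem IsSlopeEnumeration.add_rev_eq_zero {ι : Type*} [Finite ι] {r : ℕ}
    {L : Set (Γ.Point → ℝ)} {g : ι → Γ.Point → ℝ} {C : ℝ}
    (hg : IsBoundedlyGenerated L g C) (hPL : ∀ f ∈ L, IsPL f)
    {S : Γ.Tangent → Fin (r + 1) → ℤ} (hS : IsSlopeEnumeration L S) {η ξ : Γ.Tangent}
    (h : ∀ i, outSlope (g i) ξ = -outSlope (g i) η) (j : Fin (r + 1)) : S η j + S ξ j.rev = 0 := by
  refine add_rev_eq_zero_of_range_eq_neg (hS.strictMono η) (hS.strictMono ξ) ?_ j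
  rw [hS.range_eq, hS.range_eq, hg.slopeSet_eq hPL, hg.slopeSet_eq hPL, ← Set.range_comp]
  exact congrArg Set.range (funext h)

theorem exists_pt_eq_of_notMem {W : Set Γ.Point} (hW : ∀ v, Point.vertex v ∈ W) {v : Γ.Point}
    (hv : v ∉ W) : ∃ e u, 0 < u ∧ u < Γ.len e ∧ v = Γ.pt e u := by
  rcases v with v | ⟨e, u, h₀, h₁⟩
  · exact (hv (hW v)).elim
  · exact ⟨e, u, h₀, h₁, (pt_of_mem_Ioo h₀ h₁).symm⟩

theorem exists_segment_notMem {W : Set Γ.Point} (hW : W.Finite) {e : E} {u : ℝ} (h₀ : 0 < u)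
    (h₁ : u < Γ.len e) (hu : Γ.pt e u ∉ W) : ∃ s t, 0 ≤ s ∧ u ∈ Set.Ioo s t ∧ t ≤ Γ.len e ∧
      ∀ x ∈ Set.Ioo s t, Γ.pt e x ∉ W := by
  classical
  obtain ⟨ε, hε, h⟩ := exists_pos_forall_notMem (hW.toFinset.image Point.position) u
  refine ⟨max 0 (u - ε), min (Γ.len e) (u + ε), le_max_left _ _,
    ⟨max_lt h₀ (by linarith), lt_min h₁ (by linarith)⟩, min_le_left _ _, ?_⟩
  rintro x ⟨hx₁, hx₂⟩ hxW
  rw [max_lt_iff] at hx₁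
  rw [lt_min_iff] at hx₂
  have hmem : x ∈ hW.toFinset.image Point.position :=
    Finset.mem_image.2 ⟨_, hW.mem_toFinset.2 hxW, by rw [pt_of_mem_Ioo hx₁.1 hx₂.1]; rfl⟩
  rcases lt_trichotomy x u with hlt | rfl | hlt
  exacts [(h x hmem).2 ⟨hx₁.2, hlt⟩, hu hxW, (h x hmem).1 ⟨hlt, hx₂.2⟩]

variable [Finite E] {r : ℕ} {D : Γ.Divisor} {L : Set (Γ.Point → ℝ)}

/-- Translate both functions to vanish at `v`; then both attain the minimum there. This makes the
jump arrays closed under meets. -/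
theorem IsTropicalLinearSeries.exists_outSlope_eq_min (hL : IsTropicalLinearSeries r D L)
    {f g : Γ.Point → ℝ} (hf : f ∈ L) (hg : g ∈ L) (v : Γ.Point) :
    ∃ h ∈ L, ∀ η : TangentAt v, outSlope h η.1 = min (outSlope f η.1) (outSlope g η.1) := by
  let F : Bool → Γ.Point → ℝ := fun b => if b then f else g
  have hF : ∀ b, F b ∈ L := by
    rintro (_ | _)
    exacts [hg, hf]
  obtain ⟨h, hh, hcomb⟩ := hL.submodule.exists_isTropComb hF fun b => -F b v
  refine ⟨h, hh, ?_⟩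
  rintro ⟨η, rfl⟩
  have hhv : h η.base = 0 := by
    obtain ⟨i, hi⟩ := hcomb.exists_eq η.base
    rw [hi, add_neg_cancel]
  have hle : ∀ b, outSlope h η ≤ outSlope (F b) η := fun b =>
    hcomb.outSlope_le (hL.isPL hh) ((hL.isPL (hF b)).hasSlope η) (by rw [hhv, add_neg_cancel])
  obtain ⟨b, -, hb⟩ :=
    hcomb.exists_outSlope_eq (hL.isPL hh) fun b => (hL.isPL (hF b)).hasSlope η
  refine le_antisymm (le_min (hle true) (hle false)) ?_
  rw [hb]
  rcases b with _ | _
  exacts [min_le_right _ _, min_le_left _ _]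

theorem IsTropicalLinearSeries.exists_generators [Finite V] (hL : IsTropicalLinearSeries r D L) :
    ∃ G : Set (Γ.Point → ℝ), G.Finite ∧
      ∃ C, IsBoundedlyGenerated L (Subtype.val : G → Γ.Point → ℝ) C := by
  obtain ⟨G, hG, rfl⟩ := hL.finitelyGenerated
  rcases isEmpty_or_nonempty Γ.Point with h | h
  -- On the empty graph the empty family suffices.
  · exact ⟨∅, Set.finite_empty, 0, fun i => i.2.elim, fun f _ => ⟨fun _ => 0,
      ⟨fun _ x => h.elim x, fun x => h.elim x⟩, fun _ _ => by simp⟩⟩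
  · exact ⟨G, hG, exists_isBoundedlyGenerated hG fun g hg =>
      (hL.isPL (subset_tropicalSpan G hg)).exists_abs_le⟩

theorem IsTropicalLinearSeries.exists_isSlopeEnumeration [Finite V]
    (hL : IsTropicalLinearSeries r D L) :
    ∃ S : Γ.Tangent → Fin (r + 1) → ℤ, IsSlopeEnumeration L S := by
  obtain ⟨G, hG, C, hg⟩ := hL.exists_generators
  have := hG.to_subtype
  have hfin : ∀ η, (slopeSet L η).Finite := fun η => by
    rw [hg.slopeSet_eq fun f hf => hL.isPL hf]
    exact Set.finite_range _
  have hcard : ∀ η, (hfin η).toFinset.card = r + 1 := fun η => by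
    rw [← Set.ncard_eq_toFinset_card _ (hfin η)]
    exact le_antisymm (hL.ncard_slopeSet_le hg η) (hL.lt_ncard_slopeSet hg η)
  refine ⟨fun η => (hfin η).toFinset.orderEmbOfFin (hcard η), fun η => OrderEmbedding.strictMono _,
    fun η => ?_⟩
  rw [Finset.range_orderEmbOfFin, Set.Finite.coe_toFinset]

theorem IsTropicalLinearSeries.exists_pair_outSlope_lt [Finite V]
    (hL : IsTropicalLinearSeries r D L) (v : Γ.Point) (η : Fin r → Γ.Tangent) :
    ∃ f ∈ L, ∃ h ∈ L, ∀ m, (∀ ξ : TangentAt (η m).base, outSlope f ξ.1 ≤ outSlope h ξ.1) ∧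
      outSlope f (η m) < outSlope h (η m) := by
  obtain ⟨G, hG, C, hg⟩ := hL.exists_generators
  have := hG.to_subtype
  obtain ⟨f, hf⟩ := hL.nonempty v
  obtain ⟨a, ha, -⟩ := hg.exists_isTropComb f hf
  obtain ⟨i, -⟩ := ha.exists_eq v
  have : Nonempty G := ⟨i⟩
  exact hL.exists_outSlope_lt hg η

section JumpArray

variable {S : Γ.Tangent → Fin (r + 1) → ℤ}

theorem IsTropicalLinearSeries.inf_mem_jumpArray (hL : IsTropicalLinearSeries r D L)
    (hS : IsSlopeEnumeration L S) (v : Γ.Point) {x y : TangentAt v → Fin (r + 1)}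
    (hx : x ∈ jumpArray L S v) (hy : y ∈ jumpArray L S v) : x ⊓ y ∈ jumpArray L S v := by
  obtain ⟨f, hf, hfx⟩ := hx
  obtain ⟨g, hg, hgy⟩ := hy
  obtain ⟨h, hh, hmin⟩ := hL.exists_outSlope_eq_min hf hg v
  refine ⟨h, hh, fun η => ?_⟩
  rw [hmin, ← hfx, ← hgy, Pi.inf_apply]
  exact (hS.strictMono η.1).monotone.map_min

theorem IsTropicalLinearSeries.jumpArray_nonempty (hL : IsTropicalLinearSeries r D L)
    (hS : IsSlopeEnumeration L S) (v : Γ.Point) : (jumpArray L S v).Nonempty := by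
  obtain ⟨f, hf⟩ := hL.nonempty v
  obtain ⟨x, hx⟩ := hS.exists_jump hf v
  exact ⟨x, f, hf, hx⟩

/-- An axis on which a chain increases from `i` to `j` keeps all later dots above `c i`, which is
the pattern excluded by `not_outSlope_lt`. -/
theorem IsTropicalLinearSeries.not_strictMono_jumpArray (hL : IsTropicalLinearSeries r D L)
    (hS : IsSlopeEnumeration L S) (v : Γ.Point)
    (c : Fin (r + 2) → TangentAt v → Fin (r + 1)) (hc : StrictMono c) :
    ¬ ∀ m, c m ∈ jumpArray L S v := by
  intro h
  choose f hf hfc using h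
  refine hL.not_outSlope_lt v f hf fun i j hij => ?_
  obtain ⟨η, hη⟩ : ∃ η, c i η < c j η := by
    by_contra! hcon
    exact (hc hij).not_ge hcon
  refine ⟨η, fun l hl => ?_⟩
  rw [← hfc, ← hfc]
  exact hS.strictMono η.1 (hη.trans_le (hc.monotone hl η))

/-- The larger function of the pair from the limit argument exceeds another slope along every given
vector, so none of these slopes is lowest. -/
theorem IsTropicalLinearSeries.exists_mem_jumpArray_ne_zero [Finite V]
    (hL : IsTropicalLinearSeries r D L) (hS : IsSlopeEnumeration L S) (v : Γ.Point)
    (e : Fin r → TangentAt v) : ∃ x ∈ jumpArray L S v, ∀ m, x (e m) ≠ 0 := by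
  obtain ⟨f, hf, h, hh, hlt⟩ := hL.exists_pair_outSlope_lt v fun m => (e m).1
  obtain ⟨x, hx⟩ := hS.exists_jump hh v
  refine ⟨x, ⟨h, hh, hx⟩, fun m h0 => ?_⟩
  obtain ⟨j, hj⟩ := hS.exists_index hf (e m).1
  have h₁ := (hlt m).2
  rw [← hx, h0, ← hj] at h₁
  exact h₁.not_ge ((hS.strictMono _).monotone (Fin.zero_le j))

theorem IsTropicalLinearSeries.isTotallyRankable_jumpArray [Finite V]
    (hr : r = 0 ∨ r = 1 ∨ r = 2) (hL : IsTropicalLinearSeries r D L)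
    (hS : IsSlopeEnumeration L S) (v : Γ.Point) : (jumpArray L S v).IsTotallyRankable :=
  DotArray.isTotallyRankable_of_rank_le_two hr (fun _ hx _ hy => hL.inf_mem_jumpArray hS v hx hy)
    (fun η j => hS.exists_mem_jumpArray η j) (hL.not_strictMono_jumpArray hS v)
    (hL.exists_mem_jumpArray_ne_zero hS v)

theorem IsTropicalLinearSeries.exists_hasMinimalSlopes (hL : IsTropicalLinearSeries r D L)
    (hS : IsSlopeEnumeration L S) (v : Γ.Point) : ∃ f ∈ L, HasMinimalSlopes L f v := by
  obtain ⟨f, hf, h⟩ := DotArray.bot_mem (hL.jumpArray_nonempty hS v)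
    (fun _ hx _ hy => hL.inf_mem_jumpArray hS v hx hy) fun η j => hS.exists_mem_jumpArray η j
  refine ⟨f, hf, fun η g hg => ?_⟩
  obtain ⟨j, hj⟩ := hS.exists_index hg η.1
  rw [← h, ← hj]
  exact (hS.strictMono _).monotone bot_le

end JumpArray

/-! ### Rank properties for divisors of degree at most two -/

/-- In rank at most two, for every effective divisor of degree `r` there is a function in `L` that
satisfies the local conditions for the rank property at all points. -/
theorem IsTropicalLinearSeries.exists_local_conditions [Finite V]
    (hr : r ≤ 2) (hL : IsTropicalLinearSeries r D L)
    {E' : Γ.Divisor} (hE : 0 ≤ E') (hdeg : E'.deg = r) :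
    ∃ f ∈ L, ∀ v, E' v = 0 ∨ HasMinimalSlopes L f v ∨ E' v ≤ 1 ∧ HasNonmaximalSlopes L f v := by
  classical
  obtain ⟨S, hS⟩ := hL.exists_isSlopeEnumeration
  by_cases h₀ : ∀ v, E' v = 0
  · obtain ⟨f, hf, -⟩ := hL.bakerNorine E' hE hdeg
    exact ⟨f, hf, fun v => Or.inl (h₀ v)⟩
  push Not at h₀
  obtain ⟨v, hv⟩ := h₀
  by_cases h₁ : ∀ w, w ≠ v → E' w = 0
  · obtain ⟨f, hf, hmin⟩ := hL.exists_hasMinimalSlopes hS v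
    refine ⟨f, hf, fun w => ?_⟩
    by_cases hw : w = v
    · exact Or.inr (Or.inl (hw ▸ hmin))
    · exact Or.inl (h₁ w hw)
  push Not at h₁
  obtain ⟨w, hwv, hw⟩ := h₁
  have hpos : ∀ u, 0 ≤ E' u := fun u => hE u
  have hvw := E'.sum_le_deg hE {v, w}
  rw [Finset.sum_pair hwv.symm, hdeg] at hvw
  have hv' := hpos v
  have hw' := hpos w
  have hr' : r = 2 := by omega
  have hother : ∀ u, u ≠ v → u ≠ w → E' u = 0 := fun u huv huw => by
    have h := E'.sum_le_deg hE {u, v, w}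
    rw [Finset.sum_insert (by simp [huv, huw]), Finset.sum_pair hwv.symm, hdeg] at h
    have := hpos u
    omega
  suffices h : ∃ f ∈ L, (HasMinimalSlopes L f v ∨ HasNonmaximalSlopes L f v) ∧
      (HasMinimalSlopes L f w ∨ HasNonmaximalSlopes L f w) by
    obtain ⟨f, hf, hfv, hfw⟩ := h
    refine ⟨f, hf, fun u => ?_⟩
    by_cases huv : u = v
    · subst huv
      exact Or.inr (hfv.imp_right fun h => ⟨by omega, h⟩)
    by_cases huw : u = w
    · subst huw
      exact Or.inr (hfw.imp_right fun h => ⟨by omega, h⟩)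
    exact Or.inl (hother u huv huw)
  -- At an isolated point minimality of slopes is vacuous, so only the other point imposes a
  -- condition.
  rcases isEmpty_or_nonempty (TangentAt v) with hv₀ | ⟨⟨η, rfl⟩⟩
  · obtain ⟨f, hf, hmin⟩ := hL.exists_hasMinimalSlopes hS w
    exact ⟨f, hf, Or.inl fun η => hv₀.elim η, Or.inl hmin⟩
  rcases isEmpty_or_nonempty (TangentAt w) with hw₀ | ⟨⟨ξ, rfl⟩⟩
  · obtain ⟨f, hf, hmin⟩ := hL.exists_hasMinimalSlopes hS η.base
    exact ⟨f, hf, Or.inl hmin, Or.inl fun η => hw₀.elim η⟩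
  subst hr'
  -- As `r = 2`, the limit argument allows one tangent vector at each of the two points.
  obtain ⟨f, hf, h, hh, hlt⟩ := hL.exists_pair_outSlope_lt η.base ![η, ξ]
  exact ⟨f, hf, Or.inr ⟨h, hh, (hlt 0).1, ⟨η, rfl⟩, (hlt 0).2⟩,
    Or.inr ⟨h, hh, (hlt 1).1, ⟨ξ, rfl⟩, (hlt 1).2⟩⟩

/-- Smaller slopes mean larger order. Minimal slopes beat the function with order at least `E' - D`;
nonmaximal ones strictly beat a function with order at least `-D`, which by integrality gives one
chip. -/
theorem IsTropicalLinearSeries.bakerNorine_of_local_conditions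
    (hL : IsTropicalLinearSeries r D L) {E' : Γ.Divisor} (hE : 0 ≤ E') (hdeg : E'.deg = r)
    {f : Γ.Point → ℝ} (hf : f ∈ L) (h : ∀ v, E' v = 0 ∨ HasMinimalSlopes L f v ∨
      E' v ≤ 1 ∧ HasNonmaximalSlopes L f v) : BakerNorineRankProperty D E' f := by
  intro v
  rcases h v with h | h | ⟨h, g, hg, hle, hlt⟩
  · have := (hL.subset hf).2 v
    omega
  · obtain ⟨g, hg, hE'⟩ := hL.bakerNorine E' hE hdeg
    have := ord_le_ord fun η => h η g hg
    have := hE' v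
    omega
  · have := (hL.subset hg).2 v
    have := ord_lt_ord hle hlt
    omega

/-- The array `X[x]` contains `x`, so its rank is at least `0`; minimal slopes give `x = ⊥` and rank
`r`; a larger dot gives two values on one axis. -/
theorem IsTropicalLinearSeries.le_rankArray_of_local_conditions [Finite V]
    (hr : r = 0 ∨ r = 1 ∨ r = 2) (hL : IsTropicalLinearSeries r D L)
    {S : Γ.Tangent → Fin (r + 1) → ℤ} (hS : IsSlopeEnumeration L S) {v : Γ.Point} {k : ℤ}
    (hk : k ≤ r) {f : Γ.Point → ℝ} (hf : f ∈ L) {x : TangentAt v → Fin (r + 1)}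
    (hx : ∀ η : TangentAt v, S η.1 (x η) = outSlope f η.1)
    (h : k = 0 ∨ HasMinimalSlopes L f v ∨ k ≤ 1 ∧ HasNonmaximalSlopes L f v) :
    k ≤ (jumpArray L S v).prune.rankArray x := by
  refine (hL.isTotallyRankable_jumpArray hr hS v).le_rankArray_prune hk ?_
  have hmem : x ∈ DotArray.principal (jumpArray L S v) x := ⟨⟨f, hf, hx⟩, le_rfl⟩
  rcases isEmpty_or_nonempty (TangentAt v) with h₀ | ⟨⟨η⟩⟩
  · exact Or.inl h₀
  right
  rcases h with rfl | h | ⟨hk₁, g, hg, hle, η', hη'⟩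
  · refine ⟨η, ?_⟩
    have := (Set.ncard_pos (DotArray.finite_image_coord _ η)).2 ⟨_, x, hmem, rfl⟩
    simp only [DotArray.rankAlong]
    omega
  · refine ⟨η, ?_⟩
    have hx0 : x = ⊥ := by
      funext ξ
      obtain ⟨g, hg, hg0⟩ := hS.exists_mem ξ.1 ⊥
      have := h ξ g hg
      rw [← hx, hg0] at this
      exact le_bot_iff.1 ((hS.strictMono _).le_iff_le.1 this)
    rw [hx0, DotArray.principal_bot,
      DotArray.isRankable_of_coord_surjective fun η j => hS.exists_mem_jumpArray η j]
    exact hk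
  · refine ⟨η', ?_⟩
    obtain ⟨y, hy⟩ := hS.exists_jump hg v
    have hxy : x ≤ y := fun ξ => (hS.strictMono ξ.1).le_iff_le.1 (by rw [hx, hy]; exact hle ξ)
    have hlt : x η' < y η' := (hS.strictMono η'.1).lt_iff_lt.1 (by rw [hx, hy]; exact hη')
    have hone := (Set.one_lt_ncard_iff (DotArray.finite_image_coord
      (DotArray.principal (jumpArray L S v) x) η')).2
      ⟨x η', y η', ⟨x, hmem, rfl⟩, ⟨y, ⟨⟨g, hg, hy⟩, hxy⟩, rfl⟩, hlt.ne⟩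
    simp only [DotArray.rankAlong]
    omega

/-! ### The slope structure -/

theorem IsPL.exists_breakpoints [Finite V] {ι : Type*} [Finite ι] {g : ι → Γ.Point → ℝ}
    (hg : ∀ i, IsPL (g i)) (D : Γ.Divisor) :
    ∃ W : Set Γ.Point, W.Finite ∧ (∀ v, Point.vertex v ∈ W) ∧ (∀ v ∉ W, D v = 0) ∧
      (∀ i e s t, 0 ≤ s → s ≤ t → t ≤ Γ.len e → (∀ u ∈ Set.Ioo s t, Γ.pt e u ∉ W) →
        ∃ k, IsAffineOn (g i) e s t k) := by
  choose B hB using hg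
  refine ⟨Set.range Point.vertex ∪ D.support ∪ ⋃ i, ⋃ e, Γ.pt e '' (B i e), ?_, ?_, ?_, ?_⟩
  · exact ((Set.finite_range _).union D.support.finite_toSet).union
      (Set.finite_iUnion fun i => Set.finite_iUnion fun e => (B i e).finite_toSet.image _)
  · exact fun v => Or.inl (Or.inl ⟨v, rfl⟩)
  · intro v hv
    by_contra hne
    exact hv (Or.inl (Or.inr (Finset.mem_coe.2 (Finsupp.mem_support_iff.2 hne))))
  · intro i e s t h₀ h h₁ hW
    refine hB i e s t h₀ h h₁ fun b hb hmem => hW b hmem (Or.inr ?_)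
    simp only [Set.mem_iUnion]
    exact ⟨i, e, b, hb, rfl⟩

/-- Where `D` vanishes the two slopes of each function have sum at most zero, and by the reversal of
slopes the indices have sum at most `r`. -/
theorem IsTropicalLinearSeries.prune_jumpArray_eq_standard [Finite V]
    (hr : r = 0 ∨ r = 1 ∨ r = 2) (hL : IsTropicalLinearSeries r D L)
    {S : Γ.Tangent → Fin (r + 1) → ℤ} (hS : IsSlopeEnumeration L S) {e : E} {u : ℝ} (h₀ : 0 < u)
    (h₁ : u < Γ.len e) (hD : D (Γ.pt e u) = 0)
    (hrev : ∀ j, S (.fwd e u h₀.le h₁) j + S (.bwd e u h₀ h₁.le) j.rev = 0) :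
    (jumpArray L S (Γ.pt e u)).prune = DotArray.standard _ r := by
  refine DotArray.prune_eq_standard (hL.isTotallyRankable_jumpArray hr hS _)
    (fun η j => hS.exists_mem_jumpArray η j) (fwdAt_ne_bwdAt h₀ h₁)
    (eq_fwdAt_or_eq_bwdAt h₀ h₁) ?_
  rintro x ⟨f, hf, hx⟩
  have hord := (hL.subset hf).2 (Γ.pt e u)
  rw [hD, ord_interior f h₀ h₁] at hord
  have e₁ : S (.fwd e u h₀.le h₁) (x (fwdAt e u h₀.le h₁)) = _ := hx (fwdAt e u h₀.le h₁)
  have e₂ : S (.bwd e u h₀ h₁.le) (x (bwdAt e u h₀ h₁.le)) = _ := hx (bwdAt e u h₀ h₁.le)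
  have e₃ := hrev (x (bwdAt e u h₀ h₁.le)).rev
  rw [Fin.rev_rev] at e₃
  have hle : x (fwdAt e u h₀.le h₁) ≤ (x (bwdAt e u h₀ h₁.le)).rev := by
    refine (hS.strictMono (.fwd e u h₀.le h₁)).le_iff_le.1 ?_
    simp only [fwdAt, bwdAt] at e₁ e₂ e₃ ⊢
    omega
  have hle' := Fin.le_def.1 hle
  rw [Fin.val_rev] at hle'
  have := (x (bwdAt e u h₀ h₁.le)).2
  omega

/-- Outside vertices, support of `D` and break points, all generators are affine. Opposite vectors
thus see opposite slopes of generators, hence opposite sets of slopes of `L`. -/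
theorem IsTropicalLinearSeries.exists_slopeStructure [Finite V]
    (hr : r = 0 ∨ r = 1 ∨ r = 2) (hL : IsTropicalLinearSeries r D L)
    {S : Γ.Tangent → Fin (r + 1) → ℤ} (hS : IsSlopeEnumeration L S) :
    ∃ (W : Set Γ.Point) (𝔖 : SlopeStructure Γ W r), 𝔖.S = S ∧
      𝔖.P = fun v => (jumpArray L S v).prune := by
  obtain ⟨G, hG, C, hg⟩ := hL.exists_generators
  have := hG.to_subtype
  obtain ⟨W, hfin, hvert, hD, haff⟩ :=
    IsPL.exists_breakpoints (fun i : G => hL.isPL (hg.mem i)) D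
  have hopp : ∀ e u (h₀ : 0 < u) (h₁ : u < Γ.len e), Γ.pt e u ∉ W → ∀ j,
      S (.fwd e u h₀.le h₁) j + S (.bwd e u h₀ h₁.le) j.rev = 0 := by
    intro e u h₀ h₁ hu
    refine hS.add_rev_eq_zero hg (fun f hf => hL.isPL hf) fun i => ?_
    obtain ⟨s, t, hs, hst, ht, hW⟩ := exists_segment_notMem hfin h₀ h₁ hu
    obtain ⟨k, hk⟩ := haff i e s t hs (hst.1.trans hst.2).le ht hW
    rw [(hk.hasSlope_fwd ⟨hst.1.le, hst.2⟩ h₀.le h₁).outSlope_eq,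
      (hk.hasSlope_bwd ⟨hst.1, hst.2.le⟩ h₀ h₁.le).outSlope_eq]
  have htot := hL.isTotallyRankable_jumpArray hr hS
  refine ⟨W, ⟨hfin, ?_, S, hS.strictMono, fun v => (jumpArray L S v).prune, fun v => ?_, ?_, ?_,
    ?_⟩, rfl, rfl⟩
  · intro v hv
    by_contra hvW
    obtain ⟨e, u, h₀, h₁, rfl⟩ := exists_pt_eq_of_notMem hvert hvW
    exact hv (valence_interior h₀ h₁)
  · exact (htot v).isPermutationArray_prune
      (DotArray.isRankable_of_coord_surjective fun η j => hS.exists_mem_jumpArray η j)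
  · intro e s t h₀ h h₁ hW
    refine hS.add_rev_eq_zero hg (fun f hf => hL.isPL hf) fun i => ?_
    obtain ⟨k, hk⟩ := haff i e s t h₀ h.le h₁ fun u hu => hW u ⟨hu.1.le, hu.2.le⟩
    rw [(hk.hasSlope_fwd ⟨le_rfl, h⟩ _ _).outSlope_eq,
      (hk.hasSlope_bwd ⟨h, le_rfl⟩ _ _).outSlope_eq]
  · intro v hv η ξ hne j
    obtain ⟨e, u, h₀, h₁, rfl⟩ := exists_pt_eq_of_notMem hvert hv
    have hj := hopp e u h₀ h₁ hv
    rcases eq_fwdAt_or_eq_bwdAt h₀ h₁ η with rfl | rfl <;>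
      rcases eq_fwdAt_or_eq_bwdAt h₀ h₁ ξ with rfl | rfl
    · exact (hne rfl).elim
    · exact hj j
    · have := hj j.rev
      rw [Fin.rev_rev, add_comm] at this
      exact this
    · exact (hne rfl).elim
  · intro v hv
    obtain ⟨e, u, h₀, h₁, rfl⟩ := exists_pt_eq_of_notMem hvert hv
    exact hL.prune_jumpArray_eq_standard hr hS h₀ h₁ (hD _ hv) (hopp e u h₀ h₁ hv)

theorem SlopeStructure.S_jump {W : Set Γ.Point} (𝔖 : SlopeStructure Γ W r) {f : Γ.Point → ℝ}
    {v : Γ.Point} {η : TangentAt v} (h : outSlope f η.1 ∈ Set.range (𝔖.S η.1)) :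
    𝔖.S η.1 (𝔖.jump f v η) = outSlope f η.1 :=
  Classical.epsilon_spec h

theorem IsTropicalLinearSeries.isAdmissible [Finite V] (hr : r = 0 ∨ r = 1 ∨ r = 2)
    (hL : IsTropicalLinearSeries r D L) : IsAdmissible r D L where
  subset := hL.subset
  submodule := hL.submodule
  closed := by
    obtain ⟨G, hG, rfl⟩ := hL.finitelyGenerated
    exact isClosedInPL_tropicalSpan hG
      (fun g hg => (hL.isPL (subset_tropicalSpan G hg)).exists_abs_le) hL.submodule
  slopeStructure := by
    obtain ⟨S, hS⟩ := hL.exists_isSlopeEnumeration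
    obtain ⟨W, 𝔖, hSS, hP⟩ := hL.exists_slopeStructure hr hS
    have hrange : ∀ f ∈ L, ∀ η, outSlope f η ∈ Set.range (𝔖.S η) := fun f hf η => by
      rw [hSS]
      exact hS.exists_index hf η
    have hjump : ∀ f ∈ L, ∀ v, ∀ η : TangentAt v, S η.1 (𝔖.jump f v η) = outSlope f η.1 :=
      fun f hf v η => by
        rw [← hSS]
        exact 𝔖.S_jump (hrange f hf η.1)
    refine ⟨W, 𝔖, fun f hf => ⟨hL.subset hf, hrange f hf, fun v => ?_⟩, fun E' hE hdeg => ?_⟩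
    · rw [hP]
      exact (hL.isTotallyRankable_jumpArray hr hS v).subset_redundantClosure_prune
        ⟨f, hf, hjump f hf v⟩
    · obtain ⟨f, hf, h⟩ := hL.exists_local_conditions (by omega) hE hdeg
      refine ⟨f, hf, hL.bakerNorine_of_local_conditions hE hdeg hf h, fun v => ?_⟩
      rw [SlopeStructure.rankAt, hP]
      exact hL.le_rankArray_of_local_conditions hr hS (hdeg ▸ E'.le_deg hE v) hf (hjump f hf v)
        (h v)

end MetricGraph

/-! ### The equivalence -/

theorem mainTheorem7 {V E : Type*} [Finite V] [Finite E] (Γ : MetricGraph V E)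
    (r : ℕ) (hr : r = 0 ∨ r = 1 ∨ r = 2) (D : Γ.Divisor) (L : Set (Γ.Point → ℝ)) :
    MetricGraph.IsTropicalLinearSeries r D L ↔
      MetricGraph.IsCombinatorialLimitLinearSeries r D L := by
  refine ⟨fun hL => ⟨hL.isAdmissible hr, hL.finitelyGenerated, hL.dependent⟩, fun hL => ?_⟩
  obtain ⟨_, _, _, h⟩ := hL.admissible.slopeStructure
  refine ⟨hL.admissible.subset, hL.admissible.submodule, hL.finitelyGenerated, ?_, hL.dependent⟩
  intro E' hE hdeg
  obtain ⟨f, hf, hBN, -⟩ := h E' hE hdeg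
  exact ⟨f, hf, hBN⟩
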